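/- Consider an interface in the plane consisting of finitely many pairwise disjoint edges and a finite set $\mathcal V$ of vertices. Each edge $e$ is a relatively open simple rectifiable arc of length $|e|>0$ with two distinct end points, which belong to $\mathcal V$, and no vertex lies on an open edge. Functions on $e$ are complex-valued, and integrals and the tangential derivative $\partial_e$ are taken with respect to arc length. $H^1(e)$ and $H^2(e)$ are the Sobolev spaces on $e$, and $H^1_0(e)$ is the subspace of $H^1(e)$ of functions with zero trace at both end points. $H^{1/2}(e)$ is the interpolation space halfway between $L^2(e)$ and $H^1(e)$, and $H^{3/2}(e)$ is the one halfway between $H^1(e)$ and $H^2(e)$, with norms $\big(\int_0^\infty t^{-1}K(t,f)^2\,\frac{dt}{t}\big)^{1/2}$, where $K(t,f)=\inf\{\|f_0\|_{X}+t\|f_1\|_{Y}: f=f_0+f_1\}$ for the respective pair $(X,Y)=(L^2(e),H^1(e))$ or $(H^1(e),H^2(e))$. For $p\in\mathcal V$ let $\varphi_p$ be the real function on the interface which is continuous on each closed edge, harmonic along each edge (vanishing second arc-length derivative), and satisfies $\varphi_p(q)=\delta_{p,q}$ for all $q\in\mathcal V$; the nodal interpolant is $I_{\mathcal V}w=\sum_{p\in\mathcal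 V}w(p)\varphi_p$. Let $(\tau_i^e,\lambda_i^e)_{i\ge1}$, with $\tau^e_i\in H^1_0(e)$ and $\lambda^e_i\in\mathbb R$, be the edge modes, that is, an enumeration, ordered by non-decreasing eigenvalue and orthonormal in $L^2(e)$, of solutions of $$(\partial_e\tau_i^e,\partial_e\eta)_{L^2(e)}=\lambda_i^e(\tau_i^e,\eta)_{L^2(e)}\qquad\text{for all }\eta\in H_0^1(e),$$ which exhausts all eigenspaces, and put $V^e_{I}=\operatorname{span}\{\tau^e_1,\dots,\tau^e_{I}\}$. **Lemma.** For every edge $e$ there is a constant $C>0$, independent of $I_e$ and $w$, such that every $w\in H^{3/2}(e)$ has a representative which is continuous on $\overline e$ (so that $I_{\mathcal V}w$ is well defined on $e$) and, for this representative and every integer $I_e\ge1$, $$\inf_{v^e\in V^e_{I_e}}\|w-I_{\mathcal V}w-v^e\|_{H^{1/2}(e)}\le \frac{C}{\sqrt{\lambda^e_{I_e}}}\,\|w\|_{H^{3/2}(e)} .$$ -/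

import Mathlib

open Set MeasureTheory
open scoped ENNReal

noncomputable section

/-! ### Sobolev and interpolation norms on the interval `(0, L)`

Functions are considered up to equality almost everywhere. The norms take values in `[0, ∞]`;
a function belongs to a space when its norm is finite. -/

/-- Lebesgue measure on the open interval `(0, L)`. -/
def intervalMeasure (L : ℝ) : Measure ℝ := volume.restrict (Ioo 0 L)

/-- `g` is the weak derivative of `f` on `(0, L)`. -/
def IsWeakDeriv (L : ℝ) (f g : ℝ → ℂ) : Prop :=
  ∀ ψ : ℝ → ℝ, ContDiff ℝ (⊤ : ℕ∞) ψ → HasCompactSupport ψ → tsupport ψ ⊆ Ioo 0 L →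
    ∫ s in Ioo 0 L, deriv ψ s • f s = - ∫ s in Ioo 0 L, ψ s • g s

/-- `g 0 = f, g 1, …, g k` are the weak derivatives of `f` up to order `k`, all of them square
integrable on `(0, L)`. -/
def IsWeakDerivChain (L : ℝ) (k : ℕ) (f : ℝ → ℂ) (g : ℕ → ℝ → ℂ) : Prop :=
  g 0 = f ∧ (∀ i ≤ k, MemLp (g i) 2 (intervalMeasure L)) ∧
    ∀ i < k, IsWeakDeriv L (g i) (g (i + 1))

/-- The norm of `H^k(0, L)`, i.e. `(∑_{i ≤ k} ‖f^(i)‖²)^{1/2}`; it is `∞` outside `H^k(0, L)`.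
For `k = 0` this is the norm of `L²(0, L)`. (Weak derivatives are unique almost everywhere, so the
infimum is over equal values.) -/
def sobolevNorm (L : ℝ) (k : ℕ) (f : ℝ → ℂ) : ℝ≥0∞ :=
  ⨅ (g : ℕ → ℝ → ℂ) (_ : IsWeakDerivChain L k f g),
    (∑ i ∈ Finset.range (k + 1), eLpNorm (g i) 2 (intervalMeasure L) ^ 2) ^ (1 / 2 : ℝ)

/-- The `K`-functional `K(t, f) = inf { N₀ f₀ + t N₁ f₁ : f = f₀ + f₁ }` of a pair of norms. -/
def kFunctional (N₀ N₁ : (ℝ → ℂ) → ℝ≥0∞) (t : ℝ) (f : ℝ → ℂ) : ℝ≥0∞ :=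
  ⨅ f₁ : ℝ → ℂ, N₀ (f - f₁) + ENNReal.ofReal t * N₁ f₁

/-- The norm of the interpolation space halfway between the spaces normed by `N₀` and `N₁`:
`(∫_0^∞ (t^{-1/2} K(t, f))² dt/t)^{1/2}`. -/
def halfwayNorm (N₀ N₁ : (ℝ → ℂ) → ℝ≥0∞) (f : ℝ → ℂ) : ℝ≥0∞ :=
  (∫⁻ t in Ioi (0 : ℝ),
    (ENNReal.ofReal (t ^ (-(1 / 2) : ℝ)) * kFunctional N₀ N₁ t f) ^ 2 * ENNReal.ofReal t⁻¹)
      ^ (1 / 2 : ℝ)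

/-- `f ∈ H^1_0(0, L)`: `f ∈ H^1(0, L)` has vanishing trace, i.e. its continuous representative
vanishes at both end points. -/
def MemH10 (L : ℝ) (f : ℝ → ℂ) : Prop :=
  sobolevNorm L 1 f < ⊤ ∧
    ∃ h : ℝ → ℂ, ContinuousOn h (Icc 0 L) ∧ h =ᵐ[intervalMeasure L] f ∧ h 0 = 0 ∧ h L = 0

/-! ### Edges and the interface -/

/-- The Euclidean plane. -/
abbrev EuclideanPlane : Type := EuclideanSpace ℝ (Fin 2)

/-- An edge: an open simple rectifiable arc in the plane with two distinct end points, given by its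
parametrization by arc length `[0, length] → ℝ²`. Functions on the edge are functions on the plane
of which only the values on the closed arc matter; they are integrated and differentiated with
respect to arc length, i.e. after composition with `param`. -/
structure InterfaceEdge where
  length : ℝ
  length_pos : 0 < length
  param : ℝ → EuclideanPlane
  injOn : InjOn param (Icc 0 length)
  unitSpeed : HasUnitSpeedOn param (Icc 0 length)

namespace InterfaceEdge

variable (e : InterfaceEdge)

/-- The edge as a relatively open arc, without its end points. -/
def carrier : Set EuclideanPlane := e.param '' Ioo 0 e.length

/-- Equality almost everywhere on the edge. -/
def AEEqual (u w : EuclideanPlane → ℂ) : Prop :=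
  u ∘ e.param =ᵐ[intervalMeasure e.length] w ∘ e.param

/-- Continuity on the closed edge. -/
def ContinuousOnClosure (w : EuclideanPlane → ℂ) : Prop :=
  ContinuousOn (w ∘ e.param) (Icc 0 e.length)

/-- The norm of `H^{1/2}(e)`, the interpolation space between `L²(e)` and `H^1(e)`. -/
def normHHalf (u : EuclideanPlane → ℂ) : ℝ≥0∞ :=
  halfwayNorm (sobolevNorm e.length 0) (sobolevNorm e.length 1) (u ∘ e.param)

/-- The norm of `H^{3/2}(e)`, the interpolation space between `H^1(e)` and `H²(e)`. -/
def normHThreeHalves (u : EuclideanPlane → ℂ) : ℝ≥0∞ :=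
  halfwayNorm (sobolevNorm e.length 1) (sobolevNorm e.length 2) (u ∘ e.param)

/-- `τ ∈ H^1_0(e)` and `(∂_e τ, ∂_e η)_e = μ (τ, η)_e` for all `η ∈ H^1_0(e)`. -/
def IsEigenpair (τ : EuclideanPlane → ℂ) (μ : ℝ) : Prop :=
  MemH10 e.length (τ ∘ e.param) ∧
    ∀ η : ℝ → ℂ, MemH10 e.length η → ∀ dτ dη : ℝ → ℂ,
      MemLp dτ 2 (intervalMeasure e.length) → IsWeakDeriv e.length (τ ∘ e.param) dτ →
      MemLp dη 2 (intervalMeasure e.length) → IsWeakDeriv e.length η dη →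
        ∫ s in Ioo 0 e.length, dτ s * starRingEnd ℂ (dη s) =
          (μ : ℂ) * ∫ s in Ioo 0 e.length, τ (e.param s) * starRingEnd ℂ (η s)

/-- `(τ i, ev i)`, `i = 1, 2, …`, is an enumeration of the edge modes: eigenpairs that are
orthonormal in `L²(e)`, ordered by non-decreasing eigenvalue, and exhaust all eigenspaces. The
entries with index `0` are not used. -/
structure IsEdgeModes (τ : ℕ → EuclideanPlane → ℂ) (ev : ℕ → ℝ) : Prop where
  eigenpair : ∀ i, 1 ≤ i → e.IsEigenpair (τ i) (ev i)
  orthonormal : ∀ i j, 1 ≤ i → 1 ≤ j →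
    ∫ s in Ioo 0 e.length, τ i (e.param s) * starRingEnd ℂ (τ j (e.param s)) =
      if i = j then 1 else 0
  monotone : ∀ i j, 1 ≤ i → i ≤ j → ev i ≤ ev j
  exhaustive : ∀ (σ : EuclideanPlane → ℂ) (μ : ℝ), e.IsEigenpair σ μ →
    ∃ v ∈ Submodule.span ℂ (τ '' {i | 1 ≤ i ∧ ev i = μ}), e.AEEqual v σ

end InterfaceEdge

/-- The space spanned by the first `n` modes `τ 1, …, τ n`. -/
def modeSpace (τ : ℕ → EuclideanPlane → ℂ) (n : ℕ) : Submodule ℂ (EuclideanPlane → ℂ) :=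
  Submodule.span ℂ (τ '' Icc 1 n)

/-- The edges and vertices of a domain decomposition interface: finitely many pairwise disjoint open
edges, and finitely many points, the vertices, which lie on no (open) edge and include the end
points of all edges. -/
structure DecompositionInterface where
  numEdges : ℕ
  edge : Fin numEdges → InterfaceEdge
  vertices : Finset EuclideanPlane
  start_mem : ∀ k, (edge k).param 0 ∈ vertices
  end_mem : ∀ k, (edge k).param (edge k).length ∈ vertices
  vertex_notMem : ∀ p ∈ vertices, ∀ k, p ∉ (edge k).carrier
  disjoint : ∀ k l, k ≠ l → Disjoint (edge k).carrier (edge l).carrier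

namespace DecompositionInterface

variable (N : DecompositionInterface)

/-- `φ p`, `p` a vertex, are the vertex functions: `φ p` is harmonic along each edge, continuous up
to its end points, and `φ p q = δ_{p q}` for all vertices `q`. -/
structure IsVertexBasis (φ : EuclideanPlane → EuclideanPlane → ℝ) : Prop where
  nodal : ∀ p ∈ N.vertices, ∀ q ∈ N.vertices, φ p q = if p = q then 1 else 0
  continuousOn : ∀ p ∈ N.vertices, ∀ k,
    ContinuousOn (φ p ∘ (N.edge k).param) (Icc 0 (N.edge k).length)
  harmonic : ∀ p ∈ N.vertices, ∀ k,
    InnerProductSpace.HarmonicOnNhd (φ p ∘ (N.edge k).param) (Ioo 0 (N.edge k).length)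

/-- The nodal interpolant `∑_p w(p) φ_p`, the sum being over all vertices. -/
def nodalInterpolant (φ : EuclideanPlane → EuclideanPlane → ℝ) (w : EuclideanPlane → ℂ) :
    EuclideanPlane → ℂ :=
  fun x => ∑ p ∈ N.vertices, w p * (φ p x : ℂ)

end DecompositionInterface

end

/-!
Parametrize the edge by `(0, L)`. Integrating by parts, every `sin (m π s / L)` is an edge mode for
the eigenvalue `(m π / L)²`; the sines are complete in `L²(0, L)`, by uniqueness of Fourier
coefficients for odd extensions, so the modes form a Hilbert basis. The affine interpolant has a
constant derivative, which is orthogonal to the derivatives of all functions in `H¹₀(0, L)`. So if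
`r` is what remains of `f` after subtracting its affine interpolant and the terms of index at most
`n` of the mode expansion, then `r'` is an orthogonal projection of `f'`, and
`√λₙ ‖r‖ ≤ ‖r'‖ ≤ ‖f'‖`. Moreover `‖r'‖² = (r', f') = -(r, f'') ≤ ‖r‖ ‖f''‖` yields
`√λₙ ‖r'‖ ≤ ‖f''‖`. Thus `√λₙ • (f ↦ r)` is a contraction from `H¹` to `L²` and from `H²` to `H¹`,
hence also between the spaces halfway, and the theorem holds with `C = 1`.
-/

section

open scoped InnerProductSpace

/-! ### Truncated eigenfunction expansions -/

section SpectralTruncation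

variable {𝕜 ι E F : Type*} [RCLike 𝕜] [NormedAddCommGroup E] [InnerProductSpace 𝕜 E]
  [NormedAddCommGroup F] [InnerProductSpace 𝕜 F]

/-- The elements `(u, A u)` of `G` are regarded as the graph of an operator `A`, such as a
derivative. `b` is a Hilbert basis of eigenvectors of the quadratic form `‖A u‖²`, with eigenvalues
`μ i`, and `D i` is `A (b i)`. -/
structure IsGraphEigenbasis (G : Submodule 𝕜 (E × F)) (b : HilbertBasis ι 𝕜 E) (D : ι → F)
    (μ : ι → ℝ) : Prop where
  mem : ∀ i, (b i, D i) ∈ G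
  inner_snd : ∀ i, ∀ p ∈ G, ⟪D i, p.2⟫_𝕜 = μ i * ⟪b i, p.1⟫_𝕜

/-- What remains of `p = (u, A u)` when the terms of the expansion of `u` in the basis `b` whose
indices belong to `s` are removed; `D i` stands for `A (b i)`. -/
noncomputable def truncationRemainder (b : HilbertBasis ι 𝕜 E) (D : ι → F) (s : Finset ι)
    (p : E × F) : E × F :=
  p - ∑ i ∈ s, ⟪b i, p.1⟫_𝕜 • (b i, D i)

section Remainder

variable (b : HilbertBasis ι 𝕜 E) (D : ι → F) (s : Finset ι) (p : E × F)

theorem truncationRemainder_fst :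
    (truncationRemainder b D s p).1 = p.1 - ∑ i ∈ s, ⟪b i, p.1⟫_𝕜 • b i := by
  simp [truncationRemainder, Prod.fst_sum]

theorem truncationRemainder_snd :
    (truncationRemainder b D s p).2 = p.2 - ∑ i ∈ s, ⟪b i, p.1⟫_𝕜 • D i := by
  simp [truncationRemainder, Prod.snd_sum]

variable {s}

theorem inner_truncationRemainder_fst {i : ι} (hi : i ∈ s) :
    ⟪b i, (truncationRemainder b D s p).1⟫_𝕜 = 0 := by
  rw [truncationRemainder_fst, inner_sub_right, b.orthonormal.inner_right_sum _ hi, sub_self]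

end Remainder

namespace IsGraphEigenbasis

variable {G : Submodule 𝕜 (E × F)} {b : HilbertBasis ι 𝕜 E} {D : ι → F} {μ : ι → ℝ} {p : E × F}
  {lam : ℝ}

theorem truncationRemainder_mem (h : IsGraphEigenbasis G b D μ) (hp : p ∈ G) (s : Finset ι) :
    truncationRemainder b D s p ∈ G :=
  G.sub_mem hp (G.sum_mem fun i _ ↦ G.smul_mem _ (h.mem i))

theorem inner_truncationRemainder_snd_self (h : IsGraphEigenbasis G b D μ) (hp : p ∈ G)
    (s : Finset ι) :
    ⟪(truncationRemainder b D s p).2, (truncationRemainder b D s p).2⟫_𝕜 =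
      ⟪(truncationRemainder b D s p).2, p.2⟫_𝕜 := by
  have horth : ∀ i ∈ s, ⟪(truncationRemainder b D s p).2, D i⟫_𝕜 = 0 := fun i hi ↦ by
    rw [inner_eq_zero_symm, h.inner_snd i _ (h.truncationRemainder_mem hp s),
      inner_truncationRemainder_fst b D p hi, mul_zero]
  conv_lhs => rw [truncationRemainder_snd, inner_sub_right, ← truncationRemainder_snd, inner_sum]
  rw [Finset.sum_eq_zero fun i hi ↦ by rw [inner_smul_right, horth i hi, mul_zero], sub_zero]

theorem sum_mul_norm_inner_sq_le (h : IsGraphEigenbasis G b D μ) (hp : p ∈ G) (s : Finset ι) :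
    ∑ i ∈ s, μ i * ‖⟪b i, p.1⟫_𝕜‖ ^ 2 ≤ ‖p.2‖ ^ 2 := by
  have hterm : ∀ i, ⟪⟪b i, p.1⟫_𝕜 • D i, p.2⟫_𝕜 = ((μ i * ‖⟪b i, p.1⟫_𝕜‖ ^ 2 : ℝ) : 𝕜) := by
    intro i
    rw [inner_smul_left, h.inner_snd i p hp, mul_left_comm, RCLike.conj_mul]
    push_cast
    rfl
  have hinner : ⟪(truncationRemainder b D s p).2, p.2⟫_𝕜 =
      ((‖p.2‖ ^ 2 - ∑ i ∈ s, μ i * ‖⟪b i, p.1⟫_𝕜‖ ^ 2 : ℝ) : 𝕜) := by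
    rw [truncationRemainder_snd, inner_sub_left, sum_inner, Finset.sum_congr rfl fun i _ ↦ hterm i,
      inner_self_eq_norm_sq_to_K]
    push_cast
    rfl
  have hnonneg := inner_self_nonneg (𝕜 := 𝕜) (x := (truncationRemainder b D s p).2)
  rw [h.inner_truncationRemainder_snd_self hp s, hinner, RCLike.ofReal_re] at hnonneg
  exact sub_nonneg.1 hnonneg

theorem mul_norm_fst_sq_le (h : IsGraphEigenbasis G b D μ) (hp : p ∈ G) {s : Finset ι}
    (hs : ∀ i ∈ s, ⟪b i, p.1⟫_𝕜 = 0) (hlam : ∀ i ∉ s, lam ≤ μ i) :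
    lam * ‖p.1‖ ^ 2 ≤ ‖p.2‖ ^ 2 := by
  have hparseval : HasSum (fun i ↦ ‖⟪b i, p.1⟫_𝕜‖ ^ 2) (‖p.1‖ ^ 2) := by
    have hsum := RCLike.hasSum_re 𝕜 (b.hasSum_inner_mul_inner p.1 p.1)
    rw [inner_self_eq_norm_sq] at hsum
    convert hsum using 2 with i
    rw [← inner_conj_symm p.1 (b i), RCLike.conj_mul, ← RCLike.ofReal_pow, RCLike.ofReal_re]
  refine hasSum_le_of_sum_le (hparseval.mul_left lam) fun t ↦
    (Finset.sum_le_sum fun i _ ↦ ?_).trans (h.sum_mul_norm_inner_sq_le hp t)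
  by_cases hi : i ∈ s
  · rw [hs i hi, norm_zero, zero_pow two_ne_zero, mul_zero, mul_zero]
  · exact mul_le_mul_of_nonneg_right (hlam i hi) (sq_nonneg _)

theorem sqrt_mul_norm_truncationRemainder_fst_le (h : IsGraphEigenbasis G b D μ) (hp : p ∈ G)
    {s : Finset ι} (hlam : ∀ i ∉ s, lam ≤ μ i) :
    √lam * ‖(truncationRemainder b D s p).1‖ ≤ ‖(truncationRemainder b D s p).2‖ := by
  have hgap := h.mul_norm_fst_sq_le (h.truncationRemainder_mem hp s)
    (fun i hi ↦ inner_truncationRemainder_fst b D p hi) hlam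
  simpa only [Real.sqrt_mul' _ (sq_nonneg _), Real.sqrt_sq (norm_nonneg _)] using
    Real.sqrt_le_sqrt hgap

theorem norm_truncationRemainder_snd_sq_eq (h : IsGraphEigenbasis G b D μ) (hp : p ∈ G)
    (s : Finset ι) :
    ‖(truncationRemainder b D s p).2‖ ^ 2 = ‖⟪(truncationRemainder b D s p).2, p.2⟫_𝕜‖ := by
  rw [← h.inner_truncationRemainder_snd_self hp s, inner_self_eq_norm_sq_to_K, norm_pow,
    RCLike.norm_ofReal, abs_norm]

theorem norm_truncationRemainder_snd_le (h : IsGraphEigenbasis G b D μ) (hp : p ∈ G)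
    (s : Finset ι) {f : F} (hf : ∀ q ∈ G, ⟪q.2, p.2⟫_𝕜 = ⟪q.2, f⟫_𝕜) :
    ‖(truncationRemainder b D s p).2‖ ≤ ‖f‖ := by
  have hsq := h.norm_truncationRemainder_snd_sq_eq hp s
  rw [hf _ (h.truncationRemainder_mem hp s)] at hsq
  have hle := hsq.trans_le (norm_inner_le_norm _ f)
  nlinarith [norm_nonneg (truncationRemainder b D s p).2, norm_nonneg f]

theorem sqrt_mul_norm_truncationRemainder_snd_le (h : IsGraphEigenbasis G b D μ) (hp : p ∈ G)
    {s : Finset ι} (hlam : ∀ i ∉ s, lam ≤ μ i) {g : E}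
    (hg : ∀ q ∈ G, ⟪q.2, p.2⟫_𝕜 = -⟪q.1, g⟫_𝕜) :
    √lam * ‖(truncationRemainder b D s p).2‖ ≤ ‖g‖ := by
  set R := truncationRemainder b D s p
  have hsq : ‖R.2‖ * ‖R.2‖ ≤ ‖R.1‖ * ‖g‖ := by
    rw [← sq, h.norm_truncationRemainder_snd_sq_eq hp s, hg _ (h.truncationRemainder_mem hp s),
      norm_neg]
    exact norm_inner_le_norm _ g
  rcases (norm_nonneg R.2).eq_or_lt with hzero | hpos
  · rw [← hzero, mul_zero]
    exact norm_nonneg g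
  · refine le_of_mul_le_mul_right ?_ hpos
    calc √lam * ‖R.2‖ * ‖R.2‖ ≤ √lam * ‖R.1‖ * ‖g‖ := by
          rw [mul_assoc, mul_assoc]
          exact mul_le_mul_of_nonneg_left hsq (Real.sqrt_nonneg _)
      _ ≤ ‖R.2‖ * ‖g‖ := mul_le_mul_of_nonneg_right
          (h.sqrt_mul_norm_truncationRemainder_fst_le hp hlam) (norm_nonneg g)
      _ = ‖g‖ * ‖R.2‖ := mul_comm _ _

end IsGraphEigenbasis

end SpectralTruncation

variable {L : ℝ} {F f G g : ℝ → ℂ}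

/-! ### Primitives and integration by parts -/

theorem absolutelyContinuousOnInterval_of_dist_le {X Y : Type*} [PseudoMetricSpace X]
    [PseudoMetricSpace Y] {f : ℝ → X} {g : ℝ → Y} {a b : ℝ}
    (hg : AbsolutelyContinuousOnInterval g a b)
    (h : ∀ x ∈ uIcc a b, ∀ y ∈ uIcc a b, dist (f x) (f y) ≤ dist (g x) (g y)) :
    AbsolutelyContinuousOnInterval f a b := by
  rw [absolutelyContinuousOnInterval_iff] at hg ⊢
  intro ε hε
  obtain ⟨δ, hδ, hsum⟩ := hg ε hε
  refine ⟨δ, hδ, fun I hI hlen ↦ (Finset.sum_le_sum fun i hi ↦ ?_).trans_lt (hsum I hI hlen)⟩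
  exact h _ (hI.1 i hi).1 _ (hI.1 i hi).2

/-- `F` is absolutely continuous on `[0, L]` with derivative `f`, encoded as being an indefinite
integral of the integrable function `f`. -/
structure IsPrimitive (L : ℝ) (F f : ℝ → ℂ) : Prop where
  integrableOn_deriv : IntegrableOn f (Ioo 0 L)
  eq_add_integral : ∀ x ∈ Icc 0 L, F x = F 0 + ∫ t in (0 : ℝ)..x, f t

theorem isPrimitive_intervalIntegral (hf : IntegrableOn f (Ioo 0 L)) :
    IsPrimitive L (fun x ↦ ∫ t in (0 : ℝ)..x, f t) f :=
  ⟨hf, fun x _ ↦ by rw [intervalIntegral.integral_same, zero_add]⟩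

theorem isPrimitive_of_hasDerivAt (h : ∀ x, HasDerivAt F (f x) x) (hf : Continuous f) :
    IsPrimitive L F f := by
  refine ⟨hf.integrableOn_Icc.mono_set Ioo_subset_Icc_self, fun x _ ↦ ?_⟩
  rw [intervalIntegral.integral_eq_sub_of_hasDerivAt (fun y _ ↦ h y) (hf.intervalIntegrable _ _),
    add_sub_cancel]

theorem isPrimitive_const (c : ℂ) : IsPrimitive L (fun _ ↦ c) 0 :=
  isPrimitive_of_hasDerivAt (fun x ↦ hasDerivAt_const x c) continuous_const

theorem intervalIntegrable_of_integrableOn_Ioo (hf : IntegrableOn f (Ioo 0 L)) {x : ℝ}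
    (hx : x ∈ Icc 0 L) : IntervalIntegrable f volume 0 x := by
  rw [intervalIntegrable_iff_integrableOn_Ioo_of_le hx.1]
  exact hf.mono_set (Ioo_subset_Ioo_right hx.2)

namespace IsPrimitive

theorem congr (h : IsPrimitive L F f) (hF : EqOn F G (Icc 0 L)) (hf : f =ᵐ[intervalMeasure L] g) :
    IsPrimitive L G g := by
  refine ⟨h.integrableOn_deriv.congr hf, fun x hx ↦ ?_⟩
  rw [← hF hx, ← hF ⟨le_rfl, hx.1.trans hx.2⟩, h.eq_add_integral x hx,
    intervalIntegral.integral_of_le hx.1, intervalIntegral.integral_of_le hx.1,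
    integral_Ioc_eq_integral_Ioo, integral_Ioc_eq_integral_Ioo]
  congr 1
  exact integral_congr_ae (ae_restrict_of_ae_restrict_of_subset (Ioo_subset_Ioo_right hx.2) hf)

theorem add (hF : IsPrimitive L F f) (hG : IsPrimitive L G g) :
    IsPrimitive L (F + G) (f + g) := by
  refine ⟨hF.integrableOn_deriv.add hG.integrableOn_deriv, fun x hx ↦ ?_⟩
  simp only [Pi.add_apply]
  rw [hF.eq_add_integral x hx, hG.eq_add_integral x hx, intervalIntegral.integral_add
    (intervalIntegrable_of_integrableOn_Ioo hF.integrableOn_deriv hx)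
    (intervalIntegrable_of_integrableOn_Ioo hG.integrableOn_deriv hx)]
  ring

theorem const_smul (c : ℂ) (hF : IsPrimitive L F f) : IsPrimitive L (c • F) (c • f) := by
  refine ⟨hF.integrableOn_deriv.smul c, fun x hx ↦ ?_⟩
  simp only [Pi.smul_apply, intervalIntegral.integral_smul]
  rw [hF.eq_add_integral x hx, smul_add]

theorem sub (hF : IsPrimitive L F f) (hG : IsPrimitive L G g) :
    IsPrimitive L (F - G) (f - g) := by
  simpa only [sub_eq_add_neg, neg_one_smul] using hF.add (hG.const_smul (-1))

theorem conj (h : IsPrimitive L F f) :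
    IsPrimitive L (fun x ↦ starRingEnd ℂ (F x)) (fun x ↦ starRingEnd ℂ (f x)) := by
  refine ⟨Complex.conjCLE.toContinuousLinearMap.integrable_comp h.integrableOn_deriv,
    fun x hx ↦ ?_⟩
  rw [h.eq_add_integral x hx, map_add, intervalIntegral.integral_of_le hx.1,
    intervalIntegral.integral_of_le hx.1, integral_conj]

theorem absolutelyContinuousOnInterval (hL : 0 < L) (h : IsPrimitive L F f) :
    AbsolutelyContinuousOnInterval F 0 L := by
  have hInt : ∀ x ∈ uIcc 0 L, IntervalIntegrable f volume 0 x := fun x hx ↦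
    intervalIntegrable_of_integrableOn_Ioo h.integrableOn_deriv (uIcc_of_le hL.le ▸ hx)
  refine absolutelyContinuousOnInterval_of_dist_le
    ((hInt L right_mem_uIcc).norm.absolutelyContinuousOnInterval_intervalIntegral left_mem_uIcc)
    fun x hx y hy ↦ ?_
  have hsub : F x - F y = ∫ t in y..x, f t := by
    rw [← intervalIntegral.integral_interval_sub_left (hInt x hx) (hInt y hy)]
    rw [uIcc_of_le hL.le] at hx hy
    rw [h.eq_add_integral x hx, h.eq_add_integral y hy, add_sub_add_left_eq_sub]
  rw [dist_eq_norm, dist_eq_norm, hsub,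
    intervalIntegral.integral_interval_sub_left (hInt x hx).norm (hInt y hy).norm]
  exact intervalIntegral.norm_integral_le_abs_integral_norm

theorem continuousOn (hL : 0 < L) (h : IsPrimitive L F f) : ContinuousOn F (Icc 0 L) :=
  uIcc_of_le hL.le ▸ (h.absolutelyContinuousOnInterval hL).continuousOn

theorem ae_hasDerivAt (hL : 0 < L) (h : IsPrimitive L F f) :
    ∀ᵐ x, x ∈ Ioo 0 L → HasDerivAt F (f x) x := by
  have hf := intervalIntegrable_of_integrableOn_Ioo h.integrableOn_deriv (right_mem_Icc.2 hL.le)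
  filter_upwards [hf.ae_hasDerivAt_integral] with x hderiv hx
  have hxIcc : x ∈ uIcc 0 L := by
    rw [uIcc_of_le hL.le]
    exact Ioo_subset_Icc_self hx
  refine ((hderiv hxIcc 0 left_mem_uIcc).const_add (F 0)).congr_of_eventuallyEq ?_
  filter_upwards [isOpen_Ioo.mem_nhds hx] with y hy
  exact h.eq_add_integral y (Ioo_subset_Icc_self hy)

theorem eqOn_const (h : IsPrimitive L F f) (hf : f =ᵐ[intervalMeasure L] 0) :
    EqOn F (fun _ ↦ F 0) (Icc 0 L) := fun x hx ↦ by
  rw [(h.congr (eqOn_refl F _) hf).eq_add_integral x hx]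
  simp

theorem setIntegral_deriv (hL : 0 < L) (h : IsPrimitive L F f) :
    ∫ x in Ioo 0 L, f x = F L - F 0 := by
  rw [h.eq_add_integral L (right_mem_Icc.2 hL.le), intervalIntegral.integral_of_le hL.le,
    integral_Ioc_eq_integral_Ioo, add_sub_cancel_left]

end IsPrimitive

theorem isPrimitive_of_absolutelyContinuousOnInterval (hL : 0 < L)
    (hF : AbsolutelyContinuousOnInterval F 0 L) (hf : IntegrableOn f (Ioo 0 L))
    (hderiv : ∀ᵐ x, x ∈ Ioo 0 L → HasDerivAt F (f x) x) : IsPrimitive L F f := by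
  have hInt := isPrimitive_intervalIntegral hf
  have hzero : ∀ᵐ x, x ∈ uIcc 0 L → HasDerivAt (fun x ↦ F x - ∫ t in (0 : ℝ)..x, f t) 0 x := by
    have hends : ∀ᵐ x : ℝ, x ≠ 0 ∧ x ≠ L :=
      (Measure.ae_ne volume 0).and (Measure.ae_ne volume L)
    filter_upwards [hderiv, hInt.ae_hasDerivAt hL, hends] with x hFx hfx hne hx
    rw [uIcc_of_le hL.le] at hx
    have hxIoo : x ∈ Ioo 0 L := ⟨hx.1.lt_of_ne' hne.1, hx.2.lt_of_ne hne.2⟩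
    simpa only [sub_self] using (hFx hxIoo).fun_sub (hfx hxIoo)
  obtain ⟨C, hC⟩ :=
    (hF.fun_sub (hInt.absolutelyContinuousOnInterval hL)).const_of_ae_hasDerivAt_zero hzero
  rw [uIcc_of_le hL.le] at hC
  refine ⟨hf, fun x hx ↦ ?_⟩
  have h0 := hC 0 (left_mem_Icc.2 hL.le)
  rw [intervalIntegral.integral_same, sub_zero] at h0
  rw [h0, ← hC x hx, sub_add_cancel]

theorem integrableOn_continuousOn_mul (hF : ContinuousOn F (Icc 0 L))
    (hf : IntegrableOn f (Ioo 0 L)) : IntegrableOn (fun x ↦ F x * f x) (Ioo 0 L) := by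
  rw [← integrableOn_Icc_iff_integrableOn_Ioo] at hf ⊢
  exact hf.continuousOn_mul hF isCompact_Icc

theorem integrableOn_mul_continuousOn (hf : IntegrableOn f (Ioo 0 L))
    (hF : ContinuousOn F (Icc 0 L)) : IntegrableOn (fun x ↦ f x * F x) (Ioo 0 L) := by
  simpa only [mul_comm] using integrableOn_continuousOn_mul hF hf

theorem IsPrimitive.mul (hL : 0 < L) (hF : IsPrimitive L F f) (hG : IsPrimitive L G g) :
    IsPrimitive L (fun x ↦ F x * G x) (fun x ↦ f x * G x + F x * g x) := by
  refine isPrimitive_of_absolutelyContinuousOnInterval hL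
    ((hF.absolutelyContinuousOnInterval hL).fun_smul (hG.absolutelyContinuousOnInterval hL)) ?_ ?_
  · exact (integrableOn_mul_continuousOn hF.integrableOn_deriv (hG.continuousOn hL)).add
      (integrableOn_continuousOn_mul (hF.continuousOn hL) hG.integrableOn_deriv)
  · filter_upwards [hF.ae_hasDerivAt hL, hG.ae_hasDerivAt hL] with x hFx hGx hx
    exact (hFx hx).fun_mul (hGx hx)

theorem IsPrimitive.integral_deriv_mul_add_integral_mul_deriv (hL : 0 < L)
    (hF : IsPrimitive L F f) (hG : IsPrimitive L G g) :
    (∫ x in Ioo 0 L, f x * G x) + ∫ x in Ioo 0 L, F x * g x = F L * G L - F 0 * G 0 := by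
  rw [← (hF.mul hL hG).setIntegral_deriv hL, integral_add]
  · exact integrableOn_mul_continuousOn hF.integrableOn_deriv (hG.continuousOn hL)
  · exact integrableOn_continuousOn_mul (hF.continuousOn hL) hG.integrableOn_deriv

/-! ### Weak derivatives -/

theorem eq_zero_of_tsupport_subset_Ioo {ψ : ℝ → ℝ} (h : tsupport ψ ⊆ Ioo 0 L) :
    ψ 0 = 0 ∧ ψ L = 0 :=
  ⟨image_eq_zero_of_notMem_tsupport fun h0 ↦ (h h0).1.false,
    image_eq_zero_of_notMem_tsupport fun hL ↦ (h hL).2.false⟩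

theorem isPrimitive_ofReal {ψ : ℝ → ℝ} (hψ : ContDiff ℝ (⊤ : ℕ∞) ψ) :
    IsPrimitive L (fun x ↦ (ψ x : ℂ)) (fun x ↦ ((deriv ψ x : ℝ) : ℂ)) :=
  isPrimitive_of_hasDerivAt
    (fun _ ↦ (hψ.differentiable (by simp)).differentiableAt.hasDerivAt.ofReal_comp)
    (Complex.continuous_ofReal.comp (hψ.continuous_deriv (by simp)))

theorem IsPrimitive.isWeakDeriv (hL : 0 < L) (h : IsPrimitive L F f) : IsWeakDeriv L F f := by
  intro ψ hψ _ hsupp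
  have hparts := (isPrimitive_ofReal (L := L) hψ).integral_deriv_mul_add_integral_mul_deriv hL h
  obtain ⟨h0, h1⟩ := eq_zero_of_tsupport_subset_Ioo hsupp
  simp only [h0, h1, Complex.ofReal_zero, zero_mul, sub_zero] at hparts
  simp only [Complex.real_smul]
  exact eq_neg_of_add_eq_zero_left hparts

theorem integrableOn_continuous_smul {ψ : ℝ → ℝ} (hψ : Continuous ψ)
    (hf : IntegrableOn f (Ioo 0 L)) : IntegrableOn (fun s ↦ ψ s • f s) (Ioo 0 L) := by
  rw [← integrableOn_Icc_iff_integrableOn_Ioo] at hf ⊢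
  exact hf.continuousOn_smul hψ.continuousOn isCompact_Icc

theorem ae_eq_of_forall_integral_smul_eq (hf : IntegrableOn f (Ioo 0 L))
    (hg : IntegrableOn g (Ioo 0 L))
    (h : ∀ ψ : ℝ → ℝ, ContDiff ℝ (⊤ : ℕ∞) ψ → HasCompactSupport ψ → tsupport ψ ⊆ Ioo 0 L →
      ∫ s in Ioo 0 L, ψ s • f s = ∫ s in Ioo 0 L, ψ s • g s) : f =ᵐ[intervalMeasure L] g := by
  have hzero : ∀ᵐ x, x ∈ Ioo 0 L → (f - g) x = 0 := by
    refine isOpen_Ioo.ae_eq_zero_of_integral_contDiff_smul_eq_zero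
      (hf.sub hg).locallyIntegrableOn fun ψ hψ hcomp hsupp ↦ ?_
    rw [← setIntegral_eq_integral_of_forall_compl_eq_zero (s := Ioo 0 L) fun x hx ↦ by
      rw [image_eq_zero_of_notMem_tsupport fun hx' ↦ hx (hsupp hx'), zero_smul]]
    simp only [Pi.sub_apply, smul_sub]
    rw [integral_sub (integrableOn_continuous_smul hψ.continuous hf)
      (integrableOn_continuous_smul hψ.continuous hg), h ψ hψ hcomp hsupp, sub_self]
  rw [intervalMeasure, Filter.EventuallyEq, ae_restrict_iff' measurableSet_Ioo]
  filter_upwards [hzero] with x hx hxL using sub_eq_zero.1 (hx hxL)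

theorem integral_eq_zero_of_tsupport_subset_Icc {θ : ℝ → ℝ} {a b c d x : ℝ}
    (hc : c < a) (hd : b < d) (hsupp : tsupport θ ⊆ Icc a b)
    (hθ : Continuous θ) (hmean : ∫ s in c..d, θ s = 0) (hx : x ∉ Icc a b) :
    ∫ s in c..x, θ s = 0 := by
  have hvanish : ∀ y, y ∉ Icc a b → θ y = 0 := fun y hy ↦
    image_eq_zero_of_notMem_tsupport fun hy' ↦ hy (hsupp hy')
  rcases lt_or_ge x a with hxa | hax
  · refine intervalIntegral.integral_zero_ae (ae_of_all _ fun y hy ↦ hvanish y fun hy' ↦ ?_)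
    exact ((uIoc_subset_uIcc hy).2.trans_lt (max_lt hc hxa)).not_ge hy'.1
  · have hbx : b < x := not_le.1 fun hxb ↦ hx ⟨hax, hxb⟩
    have htail : ∫ s in x..d, θ s = 0 := by
      refine intervalIntegral.integral_zero_ae (ae_of_all _ fun y hy ↦ hvanish y fun hy' ↦ ?_)
      exact ((lt_min hbx hd).trans_le (uIoc_subset_uIcc hy).1).not_ge hy'.2
    rw [← hmean, ← intervalIntegral.integral_add_adjacent_intervals
      (hθ.intervalIntegrable c x) (hθ.intervalIntegrable x d), htail, add_zero]

theorem exists_Icc_of_tsupport_subset_Ioo {θ : ℝ → ℝ} (hL : 0 < L) (hcomp : HasCompactSupport θ)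
    (hsupp : tsupport θ ⊆ Ioo 0 L) : ∃ a b, 0 < a ∧ b < L ∧ tsupport θ ⊆ Icc a b := by
  rcases (tsupport θ).eq_empty_or_nonempty with hempty | hne
  · exact ⟨L / 2, L / 2, by linarith, by linarith, hempty ▸ empty_subset _⟩
  · exact ⟨sInf (tsupport θ), sSup (tsupport θ), (hsupp (hcomp.sInf_mem hne)).1,
      (hsupp (hcomp.sSup_mem hne)).2,
      fun x hx ↦ ⟨csInf_le hcomp.bddBelow hx, le_csSup hcomp.bddAbove hx⟩⟩

theorem exists_testFunction_deriv_eq {θ : ℝ → ℝ} (hL : 0 < L) (hθ : ContDiff ℝ (⊤ : ℕ∞) θ)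
    (hcomp : HasCompactSupport θ) (hsupp : tsupport θ ⊆ Ioo 0 L)
    (hmean : ∫ s in Ioo 0 L, θ s = 0) :
    ∃ ψ : ℝ → ℝ, ContDiff ℝ (⊤ : ℕ∞) ψ ∧ HasCompactSupport ψ ∧ tsupport ψ ⊆ Ioo 0 L ∧
      deriv ψ = θ := by
  obtain ⟨a, b, ha, hb, hab⟩ := exists_Icc_of_tsupport_subset_Ioo hL hcomp hsupp
  have hderiv : ∀ x, HasDerivAt (fun x ↦ ∫ t in (0 : ℝ)..x, θ t) (θ x) x := fun x ↦
    (hθ.continuous.integral_hasStrictDerivAt 0 x).hasDerivAt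
  have hsuppψ : tsupport (fun x ↦ ∫ t in (0 : ℝ)..x, θ t) ⊆ Icc a b := by
    refine closure_minimal (fun x hx ↦ by_contra fun hxab ↦ hx ?_) isClosed_Icc
    refine integral_eq_zero_of_tsupport_subset_Icc ha hb hab hθ.continuous ?_ hxab
    rw [intervalIntegral.integral_of_le hL.le, integral_Ioc_eq_integral_Ioo, hmean]
  refine ⟨fun x ↦ ∫ t in (0 : ℝ)..x, θ t, ?_, ?_, ?_, funext fun x ↦ (hderiv x).deriv⟩
  · rw [contDiff_infty_iff_deriv, funext fun x ↦ (hderiv x).deriv]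
    exact ⟨fun x ↦ (hderiv x).differentiableAt, hθ⟩
  · exact isCompact_Icc.of_isClosed_subset (isClosed_tsupport _) hsuppψ
  · exact hsuppψ.trans (Icc_subset_Ioo ha hb)

theorem exists_testFunction_integral_eq_one (hL : 0 < L) :
    ∃ χ : ℝ → ℝ, ContDiff ℝ (⊤ : ℕ∞) χ ∧ HasCompactSupport χ ∧ tsupport χ ⊆ Ioo 0 L ∧
      ∫ s in Ioo 0 L, χ s = 1 := by
  let B : ContDiffBump (L / 2) := ⟨L / 8, L / 4, by linarith, by linarith⟩
  have hsupp : tsupport (B.normed volume) ⊆ Ioo 0 L := by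
    rw [B.tsupport_normed_eq, Real.closedBall_eq_Icc]
    exact Icc_subset_Ioo (by simp only [B]; linarith) (by simp only [B]; linarith)
  refine ⟨B.normed volume, B.contDiff_normed, B.hasCompactSupport_normed, hsupp, ?_⟩
  rw [← B.integral_normed (μ := volume)]
  exact setIntegral_eq_integral_of_forall_compl_eq_zero fun x hx ↦
    image_eq_zero_of_notMem_tsupport fun hx' ↦ hx (hsupp hx')

theorem setIntegral_smul_congr (ψ : ℝ → ℝ) (h : f =ᵐ[intervalMeasure L] g) :
    ∫ s in Ioo 0 L, ψ s • f s = ∫ s in Ioo 0 L, ψ s • g s :=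
  integral_congr_ae (h.mono fun s hs ↦ congrArg (ψ s • ·) hs)

namespace IsWeakDeriv

theorem congr (h : IsWeakDeriv L f F) (hf : f =ᵐ[intervalMeasure L] g)
    (hF : F =ᵐ[intervalMeasure L] G) : IsWeakDeriv L g G := by
  intro ψ hψ hcomp hsupp
  rw [← setIntegral_smul_congr _ hf, ← setIntegral_smul_congr _ hF]
  exact h ψ hψ hcomp hsupp

theorem sub (hF : IsWeakDeriv L F f) (hG : IsWeakDeriv L G g) (hFi : IntegrableOn F (Ioo 0 L))
    (hGi : IntegrableOn G (Ioo 0 L)) (hfi : IntegrableOn f (Ioo 0 L))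
    (hgi : IntegrableOn g (Ioo 0 L)) : IsWeakDeriv L (F - G) (f - g) := by
  intro ψ hψ hcomp hsupp
  have hψ' : Continuous (deriv ψ) := hψ.continuous_deriv (by simp)
  simp only [Pi.sub_apply, smul_sub]
  rw [integral_sub (integrableOn_continuous_smul hψ' hFi) (integrableOn_continuous_smul hψ' hGi),
    integral_sub (integrableOn_continuous_smul hψ.continuous hfi)
      (integrableOn_continuous_smul hψ.continuous hgi),
    hF ψ hψ hcomp hsupp, hG ψ hψ hcomp hsupp, neg_sub_neg, neg_sub]

theorem unique (hf : IsWeakDeriv L F f) (hg : IsWeakDeriv L F g)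
    (hfi : IntegrableOn f (Ioo 0 L)) (hgi : IntegrableOn g (Ioo 0 L)) :
    f =ᵐ[intervalMeasure L] g :=
  ae_eq_of_forall_integral_smul_eq hfi hgi fun ψ hψ hcomp hsupp ↦ neg_injective <| by
    rw [← hf ψ hψ hcomp hsupp, ← hg ψ hψ hcomp hsupp]

/-- The lemma of du Bois-Reymond: a test function `φ` of mean `m` is `m • χ` plus the derivative
of a test function, so that `∫ φ f = m ∫ χ f`. -/
theorem ae_eq_const (hL : 0 < L) (h : IsWeakDeriv L f 0) (hf : IntegrableOn f (Ioo 0 L)) :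
    ∃ c : ℂ, f =ᵐ[intervalMeasure L] fun _ ↦ c := by
  obtain ⟨χ, hχ, hχcomp, hχsupp, hχone⟩ := exists_testFunction_integral_eq_one hL
  have hInt : ∀ {θ : ℝ → ℝ}, Continuous θ → IntegrableOn θ (Ioo 0 L) := fun hθ ↦
    hθ.integrableOn_Icc.mono_set Ioo_subset_Icc_self
  refine ⟨∫ s in Ioo 0 L, χ s • f s, ae_eq_of_forall_integral_smul_eq hf
    (integrableOn_const (by simp)) fun φ hφ hφcomp hφsupp ↦ ?_⟩
  set m := ∫ s in Ioo 0 L, φ s with hm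
  obtain ⟨ψ, hψ, hψcomp, hψsupp, hderiv⟩ := exists_testFunction_deriv_eq hL
    (θ := fun x ↦ φ x - m * χ x) (hφ.sub (contDiff_const.mul hχ))
    (hφcomp.sub (hχcomp.mul_left (f := fun _ ↦ m)))
    ((tsupport_sub φ (fun x ↦ m * χ x)).trans
      (union_subset hφsupp ((tsupport_mul_subset_right (f := fun _ ↦ m)).trans hχsupp)))
    (by rw [integral_sub (hInt hφ.continuous) ((hInt hχ.continuous).const_mul m),
      integral_const_mul, hχone, mul_one, sub_self])
  have hzero := h ψ hψ hψcomp hψsupp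
  simp only [hderiv, sub_smul, mul_smul, Pi.zero_apply, smul_zero, integral_zero, neg_zero]
    at hzero
  have hχf : IntegrableOn (fun s ↦ m • χ s • f s) (Ioo 0 L) :=
    (integrableOn_continuous_smul hχ.continuous hf).smul m
  rw [integral_sub (integrableOn_continuous_smul hφ.continuous hf) hχf, integral_smul] at hzero
  rw [integral_smul_const, ← hm, sub_eq_zero.1 hzero]

theorem exists_isPrimitive (hL : 0 < L) (h : IsWeakDeriv L f g) (hf : IntegrableOn f (Ioo 0 L))
    (hg : IntegrableOn g (Ioo 0 L)) : ∃ F, IsPrimitive L F g ∧ F =ᵐ[intervalMeasure L] f := by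
  have hG := isPrimitive_intervalIntegral hg
  have hGi : IntegrableOn (fun x ↦ ∫ t in (0 : ℝ)..x, g t) (Ioo 0 L) :=
    (hG.continuousOn hL).integrableOn_Icc.mono_set Ioo_subset_Icc_self
  have hconst := h.sub (hG.isWeakDeriv hL) hf hGi hg hg
  rw [sub_self] at hconst
  obtain ⟨c, hc⟩ := hconst.ae_eq_const hL (hf.sub hGi)
  refine ⟨fun x ↦ c + ∫ t in (0 : ℝ)..x, g t, ⟨hg, fun x _ ↦ by simp⟩, ?_⟩
  filter_upwards [hc] with x hx
  rw [← hx, Pi.sub_apply, sub_add_cancel]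

end IsWeakDeriv

theorem eqOn_Icc_of_ae_eq_intervalMeasure (hL : 0 < L) (h : f =ᵐ[intervalMeasure L] g)
    (hf : ContinuousOn f (Icc 0 L)) (hg : ContinuousOn g (Icc 0 L)) : EqOn f g (Icc 0 L) := by
  refine Measure.eqOn_Icc_of_ae_eq volume hL.ne ?_ hf hg
  rwa [← restrict_Ioo_eq_restrict_Icc]

theorem IsWeakDeriv.isPrimitive_of_continuousOn (hL : 0 < L) (h : IsWeakDeriv L f g)
    (hf : IntegrableOn f (Ioo 0 L)) (hg : IntegrableOn g (Ioo 0 L))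
    (hF : ContinuousOn F (Icc 0 L)) (hFf : F =ᵐ[intervalMeasure L] f) : IsPrimitive L F g := by
  obtain ⟨G, hG, hGf⟩ := h.exists_isPrimitive hL hf hg
  exact hG.congr
    (eqOn_Icc_of_ae_eq_intervalMeasure hL (hGf.trans hFf.symm) (hG.continuousOn hL) hF) .rfl

/-! ### Completeness of the sines -/

theorem ae_eq_zero_of_fourierCoeffOn_eq_zero {a b : ℝ} (hab : a < b)
    (hf : MemLp f 2 (volume.restrict (Ioc a b))) (hcoeff : ∀ n, fourierCoeffOn hab f n = 0) :
    f =ᵐ[volume.restrict (Ioc a b)] 0 := by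
  have hparseval := hasSum_sq_fourierCoeffOn hab hf
  simp only [hcoeff, norm_zero, zero_pow two_ne_zero] at hparseval
  have hzero := hparseval.unique hasSum_zero
  rw [smul_eq_zero_iff_right (inv_ne_zero (sub_pos.2 hab).ne'),
    intervalIntegral.integral_of_le hab.le, integral_eq_zero_iff_of_nonneg
      (fun x ↦ by positivity) (hf.integrable_norm_pow two_ne_zero)] at hzero
  filter_upwards [hzero] with x hx
  simpa using hx

theorem intervalIntegral_mul_sub_comp_neg (hF : Continuous F)
    (hf : IntervalIntegrable f volume (-L) L) :
    ∫ x in -L..L, F x * (f x - f (-x)) = ∫ x in -L..L, (F x - F (-x)) * f x := by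
  have hfneg : IntervalIntegrable (fun x ↦ f (-x)) volume (-L) L := by
    simpa only [neg_neg] using ((IntervalIntegrable.iff_comp_neg (by finiteness)).1 hf).symm
  have hsymm := intervalIntegral.integral_comp_neg (a := -L) (b := L) fun x ↦ F (-x) * f x
  simp only [neg_neg] at hsymm
  have hFneg : Continuous fun x ↦ F (-x) := hF.comp continuous_neg
  simp only [mul_sub, sub_mul]
  rw [intervalIntegral.integral_sub (hf.continuousOn_mul hF.continuousOn)
      (hfneg.continuousOn_mul hF.continuousOn), hsymm,
    intervalIntegral.integral_sub (hf.continuousOn_mul hF.continuousOn)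
      (hf.continuousOn_mul hFneg.continuousOn)]

theorem fourier_neg_coe_sub_fourier_neg_coe_neg (hL : 0 < L) (n : ℤ) (x : ℝ) :
    (fourier (-n) (x : AddCircle (L - -L)) : ℂ) - fourier (-n) ((-x : ℝ) : AddCircle (L - -L)) =
      -2 * Complex.I * Real.sin (n * Real.pi * x / L) := by
  have hL' : (L : ℂ) ≠ 0 := Complex.ofReal_ne_zero.2 hL.ne'
  have hexp : ∀ y : ℝ, (fourier (-n) (y : AddCircle (L - -L)) : ℂ) =
      Complex.exp (-((n * Real.pi * y / L : ℝ) : ℂ) * Complex.I) := by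
    intro y
    rw [fourier_coe_apply]
    congr 1
    push_cast
    field_simp
    ring
  rw [hexp, hexp, Complex.ofReal_sin, Complex.sin, mul_neg, neg_div, Complex.ofReal_neg, neg_neg]
  linear_combination (Complex.exp (-((n * Real.pi * x / L : ℝ) : ℂ) * Complex.I) -
    Complex.exp (((n * Real.pi * x / L : ℝ) : ℂ) * Complex.I)) * Complex.I_sq

theorem fourierCoeffOn_sub_comp_neg (hL : 0 < L) (hLL : -L < L)
    (hf : IntervalIntegrable f volume (-L) L) (n : ℤ) :
    fourierCoeffOn hLL (fun x ↦ f x - f (-x)) n = (1 / (L - -L)) •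
      (-2 * Complex.I * ∫ x in -L..L, (Real.sin (n * Real.pi * x / L) : ℂ) * f x) := by
  have hcont : Continuous fun x : ℝ ↦ (fourier (-n) (x : AddCircle (L - -L)) : ℂ) :=
    (map_continuous (fourier (-n))).comp (AddCircle.continuous_mk' _)
  rw [fourierCoeffOn_eq_integral]
  simp only [smul_eq_mul]
  rw [intervalIntegral_mul_sub_comp_neg hcont hf]
  simp only [fourier_neg_coe_sub_fourier_neg_coe_neg hL, mul_assoc,
    intervalIntegral.integral_const_mul]

theorem integral_sin_int_mul_eq_zero
    (h : ∀ m : ℕ, 1 ≤ m → ∫ s in Ioo 0 L, (Real.sin (m * Real.pi * s / L) : ℂ) * f s = 0) (n : ℤ) :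
    ∫ s in Ioo 0 L, (Real.sin (n * Real.pi * s / L) : ℂ) * f s = 0 := by
  have hnat : ∀ m : ℕ, ∫ s in Ioo 0 L, (Real.sin (m * Real.pi * s / L) : ℂ) * f s = 0 := by
    intro m
    rcases m.eq_zero_or_pos with rfl | hm
    · simp
    · exact h m hm
  obtain ⟨m, rfl | rfl⟩ := n.eq_nat_or_neg
  · simpa only [Int.cast_natCast] using hnat m
  · simp only [Int.cast_neg, Int.cast_natCast, neg_mul, neg_div, Real.sin_neg, Complex.ofReal_neg,
      integral_neg, hnat m, neg_zero]

theorem ae_eq_zero_of_forall_integral_sin_mul_eq_zero (hL : 0 < L)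
    (hf : MemLp f 2 (intervalMeasure L))
    (h : ∀ m : ℕ, 1 ≤ m → ∫ s in Ioo 0 L, (Real.sin (m * Real.pi * s / L) : ℂ) * f s = 0) :
    f =ᵐ[intervalMeasure L] 0 := by
  have hLL : -L < L := by linarith
  have hsub : Ioo 0 L ⊆ Ioc (-L) L :=
    Ioo_subset_Ioc_self.trans (Ioc_subset_Ioc_left (neg_nonpos.2 hL.le))
  set f₀ := (Ioo 0 L).indicator f with hf₀
  have hmem : MemLp f₀ 2 volume := (memLp_indicator_iff_restrict measurableSet_Ioo).2 hf
  have hInt : IntervalIntegrable f₀ volume (-L) L :=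
    (intervalIntegrable_iff_integrableOn_Ioc_of_le hLL.le).2
      ((hmem.restrict _).integrable one_le_two)
  have hcoeff : ∀ n, fourierCoeffOn hLL (fun x ↦ f₀ x - f₀ (-x)) n = 0 := by
    intro n
    have hmul : (fun x ↦ (Real.sin (n * Real.pi * x / L) : ℂ) * f₀ x) =
        (Ioo 0 L).indicator fun x ↦ (Real.sin (n * Real.pi * x / L) : ℂ) * f x :=
      funext fun x ↦ (indicator_mul_right (Ioo 0 L)
        (fun x : ℝ ↦ (Real.sin (n * Real.pi * x / L) : ℂ)) f).symm
    rw [fourierCoeffOn_sub_comp_neg hL hLL hInt, intervalIntegral.integral_of_le hLL.le, hmul,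
      setIntegral_indicator measurableSet_Ioo, inter_eq_right.2 hsub,
      integral_sin_int_mul_eq_zero h, mul_zero, smul_zero]
  have hodd := ae_eq_zero_of_fourierCoeffOn_eq_zero hLL ((hmem.sub
    (hmem.comp_measurePreserving (Measure.measurePreserving_neg volume))).restrict _) hcoeff
  filter_upwards [ae_restrict_of_ae_restrict_of_subset hsub hodd, ae_restrict_mem measurableSet_Ioo]
    with x hx hxL
  have hneg : -x ∉ Ioo 0 L := fun hxneg ↦ by linarith [hxneg.1, hxL.1]
  simpa only [hf₀, Pi.sub_apply, Function.comp_apply, indicator_of_mem hxL,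
    indicator_of_notMem hneg, sub_zero] using hx

/-! ### The derivative on `H¹₀(0, L)` as an operator on `L²(0, L)` -/

instance isFiniteMeasure_intervalMeasure (L : ℝ) : IsFiniteMeasure (intervalMeasure L) := by
  unfold intervalMeasure
  infer_instance

theorem integrableOn_of_memLp_two (hf : MemLp f 2 (intervalMeasure L)) :
    IntegrableOn f (Ioo 0 L) :=
  hf.integrable one_le_two

theorem memLp_intervalMeasure_of_continuousOn (hf : ContinuousOn f (Icc 0 L)) :
    MemLp f 2 (intervalMeasure L) := by
  obtain ⟨C, hC⟩ := isCompact_Icc.exists_bound_of_continuousOn hf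
  refine MemLp.of_bound ((hf.mono Ioo_subset_Icc_self).aestronglyMeasurable measurableSet_Ioo) C ?_
  exact (ae_restrict_mem measurableSet_Ioo).mono fun x hx ↦ hC x (Ioo_subset_Icc_self hx)

theorem IsPrimitive.memLp (hL : 0 < L) (h : IsPrimitive L F f) : MemLp F 2 (intervalMeasure L) :=
  memLp_intervalMeasure_of_continuousOn (h.continuousOn hL)

theorem inner_eq_setIntegral_mul_conj {u v : Lp ℂ 2 (intervalMeasure L)}
    (hu : u =ᵐ[intervalMeasure L] f) (hv : v =ᵐ[intervalMeasure L] g) :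
    ⟪u, v⟫_ℂ = ∫ s in Ioo 0 L, g s * starRingEnd ℂ (f s) := by
  rw [L2.inner_def]
  refine integral_congr_ae ?_
  filter_upwards [hu, hv] with s hus hvs
  rw [hus, hvs, RCLike.inner_apply]

theorem exists_isWeakDerivChain_of_sobolevNorm_lt_top {k : ℕ} (h : sobolevNorm L k f < ⊤) :
    ∃ g, IsWeakDerivChain L k f g := by
  obtain ⟨g, hg⟩ := iInf_lt_iff.1 h
  obtain ⟨hchain, -⟩ := iInf_lt_iff.1 hg
  exact ⟨g, hchain⟩

theorem IsWeakDerivChain.sobolevNorm_lt_top {k : ℕ} {g : ℕ → ℝ → ℂ}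
    (h : IsWeakDerivChain L k f g) : sobolevNorm L k f < ⊤ := by
  refine (iInf₂_le g h).trans_lt (ENNReal.rpow_lt_top_of_nonneg (by norm_num) ?_)
  refine (ENNReal.sum_lt_top.2 fun i hi ↦ ?_).ne
  exact ENNReal.pow_lt_top (h.2.1 i (Finset.mem_range_succ_iff.1 hi)).2

theorem IsWeakDeriv.isWeakDerivChain_one (h : IsWeakDeriv L F f)
    (hF : MemLp F 2 (intervalMeasure L)) (hf : MemLp f 2 (intervalMeasure L)) :
    IsWeakDerivChain L 1 F fun i ↦ if i = 0 then F else f := by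
  refine ⟨if_pos rfl, fun i _ ↦ ?_, fun i hi ↦ ?_⟩
  · beta_reduce
    split_ifs
    exacts [hF, hf]
  · obtain rfl : i = 0 := by omega
    exact h

theorem MemH10.exists_isWeakDeriv (h : MemH10 L f) : MemLp f 2 (intervalMeasure L) ∧
    ∃ g, MemLp g 2 (intervalMeasure L) ∧ IsWeakDeriv L f g := by
  obtain ⟨g, rfl, hmem, hderiv⟩ := exists_isWeakDerivChain_of_sobolevNorm_lt_top h.1
  exact ⟨hmem 0 zero_le_one, g 1, hmem 1 le_rfl, hderiv 0 one_pos⟩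

/-- The graph of `u ↦ u'` on `H¹₀(0, L)`, as a subspace of `L²(0, L) × L²(0, L)`. -/
noncomputable def dirichletGraph (L : ℝ) :
    Submodule ℂ (Lp ℂ 2 (intervalMeasure L) × Lp ℂ 2 (intervalMeasure L)) where
  carrier := {p | ∃ F : ℝ → ℂ, IsPrimitive L F p.2 ∧ F =ᵐ[intervalMeasure L] p.1 ∧
    F 0 = 0 ∧ F L = 0}
  zero_mem' := ⟨0, (isPrimitive_const 0).congr (eqOn_refl _ _) (Lp.coeFn_zero ..).symm,
    (Lp.coeFn_zero ..).symm, rfl, rfl⟩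
  add_mem' := by
    rintro p q ⟨F, hF, hFp, hF0, hFL⟩ ⟨G, hG, hGq, hG0, hGL⟩
    exact ⟨F + G, (hF.add hG).congr (eqOn_refl _ _) (Lp.coeFn_add _ _).symm,
      (hFp.add hGq).trans (Lp.coeFn_add _ _).symm, by simp [hF0, hG0], by simp [hFL, hGL]⟩
  smul_mem' := by
    rintro c p ⟨F, hF, hFp, hF0, hFL⟩
    exact ⟨c • F, (hF.const_smul c).congr (eqOn_refl _ _) (Lp.coeFn_smul _ _).symm,
      (hFp.const_smul c).trans (Lp.coeFn_smul _ _).symm, by simp [hF0], by simp [hFL]⟩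

theorem IsPrimitive.toLp_mem_dirichletGraph (h : IsPrimitive L F f) (hF0 : F 0 = 0)
    (hFL : F L = 0) (hF : MemLp F 2 (intervalMeasure L)) (hf : MemLp f 2 (intervalMeasure L)) :
    (hF.toLp F, hf.toLp f) ∈ dirichletGraph L :=
  ⟨F, h.congr (eqOn_refl _ _) hf.coeFn_toLp.symm, hF.coeFn_toLp.symm, hF0, hFL⟩

theorem MemH10.toLp_mem_dirichletGraph (hL : 0 < L) (h : MemH10 L F) (hderiv : IsWeakDeriv L F f)
    (hF : MemLp F 2 (intervalMeasure L)) (hf : MemLp f 2 (intervalMeasure L)) :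
    (hF.toLp F, hf.toLp f) ∈ dirichletGraph L := by
  obtain ⟨-, G, hG, hGF, hG0, hGL⟩ := h
  have hprim := hderiv.isPrimitive_of_continuousOn hL (integrableOn_of_memLp_two hF)
    (integrableOn_of_memLp_two hf) hG hGF
  exact ⟨G, hprim.congr (eqOn_refl _ _) hf.coeFn_toLp.symm, hGF.trans hF.coeFn_toLp.symm, hG0, hGL⟩

section DirichletGraph

variable {p : Lp ℂ 2 (intervalMeasure L) × Lp ℂ 2 (intervalMeasure L)}

theorem isWeakDeriv_of_mem_dirichletGraph (hL : 0 < L) (hp : p ∈ dirichletGraph L) :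
    IsWeakDeriv L p.1 p.2 := by
  obtain ⟨F, hF, hFp, -⟩ := hp
  exact (hF.isWeakDeriv hL).congr hFp .rfl

theorem memH10_of_mem_dirichletGraph (hL : 0 < L) (hp : p ∈ dirichletGraph L) :
    MemH10 L p.1 := by
  have hchain := (isWeakDeriv_of_mem_dirichletGraph hL hp).isWeakDerivChain_one (Lp.memLp _)
    (Lp.memLp _)
  obtain ⟨F, hF, hFp, hF0, hFL⟩ := hp
  exact ⟨hchain.sobolevNorm_lt_top, F, hF.continuousOn hL, hFp, hF0, hFL⟩

theorem fst_eq_zero_of_mem_dirichletGraph (hp : p ∈ dirichletGraph L) (h : p.2 = 0) :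
    p.1 = 0 := by
  obtain ⟨F, hF, hFp, hF0, -⟩ := hp
  rw [Lp.eq_zero_iff_ae_eq_zero]
  have hFzero := hF.eqOn_const (h ▸ Lp.coeFn_zero ..)
  filter_upwards [hFp, ae_restrict_mem measurableSet_Ioo] with s hs hsL
  rw [← hs, hFzero (Ioo_subset_Icc_self hsL), hF0, Pi.zero_apply]

theorem inner_snd_toLp_eq_neg_of_mem_dirichletGraph (hL : 0 < L) (hp : p ∈ dirichletGraph L)
    (h : IsWeakDeriv L f g) (hf : MemLp f 2 (intervalMeasure L))
    (hg : MemLp g 2 (intervalMeasure L)) : ⟪p.2, hf.toLp f⟫_ℂ = -⟪p.1, hg.toLp g⟫_ℂ := by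
  obtain ⟨F, hF, hFp, hF0, hFL⟩ := hp
  obtain ⟨G, hG, hGf⟩ := h.exists_isPrimitive hL (integrableOn_of_memLp_two hf)
    (integrableOn_of_memLp_two hg)
  have hparts := hG.integral_deriv_mul_add_integral_mul_deriv hL hF.conj
  simp only [hF0, hFL, map_zero, mul_zero, sub_zero] at hparts
  rw [inner_eq_setIntegral_mul_conj .rfl (hf.coeFn_toLp.trans hGf.symm),
    inner_eq_setIntegral_mul_conj hFp.symm hg.coeFn_toLp]
  exact eq_neg_of_add_eq_zero_right hparts

end DirichletGraph

/-! ### Sobolev norms and interpolation -/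

theorem sobolevNorm_le_of_ae_eq {k : ℕ} (h : f =ᵐ[intervalMeasure L] g) :
    sobolevNorm L k f ≤ sobolevNorm L k g := by
  refine le_iInf₂ fun d hd ↦ ?_
  have hae : ∀ i, Function.update d 0 f i =ᵐ[intervalMeasure L] d i := by
    intro i
    rcases eq_or_ne i 0 with rfl | hi
    · rwa [Function.update_self, hd.1]
    · rw [Function.update_of_ne hi]
  have hchain : IsWeakDerivChain L k f (Function.update d 0 f) :=
    ⟨Function.update_self _ _ _, fun i hi ↦ (memLp_congr_ae (hae i)).2 (hd.2.1 i hi),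
      fun i hi ↦ (hd.2.2 i hi).congr (hae i).symm (hae (i + 1)).symm⟩
  refine (iInf₂_le _ hchain).trans_eq ?_
  simp only [fun i ↦ eLpNorm_congr_ae (p := 2) (hae i)]

theorem mul_rpow_half_eq (c x : ℝ≥0∞) : c * x ^ (1 / 2 : ℝ) = (c ^ 2 * x) ^ (1 / 2 : ℝ) := by
  rw [ENNReal.mul_rpow_of_nonneg _ _ (by norm_num), ← ENNReal.rpow_natCast, ← ENNReal.rpow_mul]
  norm_num

theorem IsWeakDerivChain.mul_sobolevNorm_le {k : ℕ} {c : ℝ≥0∞} {d d' : ℕ → ℝ → ℂ}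
    (hd : IsWeakDerivChain L k f d)
    (h : ∀ i ≤ k, c * eLpNorm (d i) 2 (intervalMeasure L) ≤
      eLpNorm (d' (i + 1)) 2 (intervalMeasure L)) :
    c * sobolevNorm L k f ≤
      (∑ i ∈ Finset.range (k + 2), eLpNorm (d' i) 2 (intervalMeasure L) ^ 2) ^ (1 / 2 : ℝ) := by
  refine (mul_le_mul_right (iInf₂_le d hd) c).trans ?_
  rw [mul_rpow_half_eq, Finset.mul_sum, Finset.sum_range_succ' _ (k + 1)]
  refine ENNReal.rpow_le_rpow (le_add_right (Finset.sum_le_sum fun i hi ↦ ?_)) (by norm_num)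
  rw [← mul_pow]
  exact pow_le_pow_left' (h i (Finset.mem_range_succ_iff.1 hi)) 2

theorem exists_isPrimitive_of_sobolevNorm_lt_top (hL : 0 < L) {k : ℕ}
    (h : sobolevNorm L (k + 1) f < ⊤) :
    ∃ F f', IsPrimitive L F f' ∧ F =ᵐ[intervalMeasure L] f := by
  obtain ⟨d, rfl, hd, hderiv⟩ := exists_isWeakDerivChain_of_sobolevNorm_lt_top h
  exact ⟨_, d 1, ((hderiv 0 k.succ_pos).exists_isPrimitive hL
    (integrableOn_of_memLp_two (hd 0 k.succ.zero_le))
    (integrableOn_of_memLp_two (hd 1 (Nat.le_add_left 1 k)))).choose_spec⟩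

section Interpolation

variable {N₀ N₁ M₀ M₁ : (ℝ → ℂ) → ℝ≥0∞} {c : ℝ≥0∞} {t : ℝ}

theorem mul_kFunctional_le (ht : 0 < t)
    (h : ∀ f₁, M₁ f₁ < ⊤ → ∃ g₁, c * N₀ (g - g₁) ≤ M₀ (f - f₁) ∧ c * N₁ g₁ ≤ M₁ f₁) :
    c * kFunctional N₀ N₁ t g ≤ kFunctional M₀ M₁ t f := by
  refine le_iInf fun f₁ ↦ ?_
  rcases eq_top_or_lt_top (M₁ f₁) with htop | hfin
  · rw [htop, ENNReal.mul_top (ENNReal.ofReal_pos.2 ht).ne', add_top]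
    exact le_top
  obtain ⟨g₁, h₀, h₁⟩ := h f₁ hfin
  calc c * kFunctional N₀ N₁ t g
      ≤ c * (N₀ (g - g₁) + ENNReal.ofReal t * N₁ g₁) := by gcongr; exact iInf_le _ g₁
    _ = c * N₀ (g - g₁) + ENNReal.ofReal t * (c * N₁ g₁) := by ring
    _ ≤ M₀ (f - f₁) + ENNReal.ofReal t * M₁ f₁ := by gcongr

theorem mul_halfwayNorm_le (hc : c ≠ ⊤)
    (h : ∀ t, 0 < t → c * kFunctional N₀ N₁ t g ≤ kFunctional M₀ M₁ t f) :
    c * halfwayNorm N₀ N₁ g ≤ halfwayNorm M₀ M₁ f := by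
  unfold halfwayNorm
  rw [mul_rpow_half_eq, ← lintegral_const_mul' _ _ (ENNReal.pow_ne_top hc)]
  refine ENNReal.rpow_le_rpow (setLIntegral_mono' measurableSet_Ioi fun t ht ↦ ?_) (by norm_num)
  rw [← mul_assoc, ← mul_pow, mul_left_comm]
  gcongr
  exact h t ht

theorem exists_kFunctional_lt_top (h : halfwayNorm N₀ N₁ f < ⊤) :
    ∃ t, 0 < t ∧ kFunctional N₀ N₁ t f < ⊤ := by
  by_contra! hK
  have hintegrand : ∀ t ∈ Ioi (0 : ℝ), (ENNReal.ofReal (t ^ (-(1 / 2) : ℝ)) *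
      kFunctional N₀ N₁ t f) ^ 2 * ENNReal.ofReal t⁻¹ = ⊤ := by
    intro t ht
    have hpow := ENNReal.ofReal_pos.2 (Real.rpow_pos_of_pos ht (-(1 / 2)))
    rw [top_le_iff.1 (hK t ht), ENNReal.mul_top hpow.ne', ENNReal.top_pow two_ne_zero,
      ENNReal.top_mul (ENNReal.ofReal_pos.2 (inv_pos.2 ht)).ne']
  refine h.ne ?_
  rw [halfwayNorm, setLIntegral_congr_fun measurableSet_Ioi hintegrand, setLIntegral_const,
    Real.volume_Ioi, ENNReal.top_mul_top, ENNReal.top_rpow_of_pos (by norm_num)]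

theorem exists_lt_top_of_halfwayNorm_lt_top (h : halfwayNorm N₀ N₁ f < ⊤) :
    ∃ f₁, N₀ (f - f₁) < ⊤ ∧ N₁ f₁ < ⊤ := by
  obtain ⟨t, ht, hK⟩ := exists_kFunctional_lt_top h
  obtain ⟨f₁, hf₁⟩ := iInf_lt_iff.1 hK
  obtain ⟨h₀, h₁⟩ := ENNReal.add_lt_top.1 hf₁
  exact ⟨f₁, h₀, ENNReal.lt_top_of_mul_ne_top_right h₁.ne (ENNReal.ofReal_pos.2 ht).ne'⟩

end Interpolation

/-! ### Truncation after removal of the affine interpolant -/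

/-- The linear map which sends `f` to the affine function with the same values at `0` and `L`. -/
noncomputable def affineInterpolant (L : ℝ) : (ℝ → ℂ) →ₗ[ℂ] (ℝ → ℂ) where
  toFun f s := f 0 + (s / L : ℝ) * (f L - f 0)
  map_add' f g := by
    ext s
    simp only [Pi.add_apply]
    ring
  map_smul' c f := by
    ext s
    simp only [Pi.smul_apply, smul_eq_mul, RingHom.id_apply]
    ring

theorem affineInterpolant_apply (f : ℝ → ℂ) (s : ℝ) :
    affineInterpolant L f s = f 0 + (s / L : ℝ) * (f L - f 0) :=
  rfl

theorem affineInterpolant_apply_zero (f : ℝ → ℂ) : affineInterpolant L f 0 = f 0 := by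
  rw [affineInterpolant_apply, zero_div, Complex.ofReal_zero, zero_mul, add_zero]

theorem affineInterpolant_apply_right (hL : 0 < L) (f : ℝ → ℂ) :
    affineInterpolant L f L = f L := by
  rw [affineInterpolant_apply, div_self hL.ne', Complex.ofReal_one, one_mul, add_sub_cancel]

theorem isPrimitive_affineInterpolant (f : ℝ → ℂ) :
    IsPrimitive L (affineInterpolant L f) fun _ ↦ ((1 / L : ℝ) : ℂ) * (f L - f 0) :=
  isPrimitive_of_hasDerivAt (fun s ↦ ((((hasDerivAt_id s).div_const L).ofReal_comp).mul_const
    (f L - f 0)).const_add (f 0)) continuous_const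

/-- The difference of `f` and its affine interpolant, minus the terms of its expansion in the basis
`b` of `L²(0, L)` whose indices belong to `s`. -/
noncomputable def modeResidual {ι : Type*} (b : HilbertBasis ι ℂ (Lp ℂ 2 (intervalMeasure L)))
    (s : Finset ι) (f : ℝ → ℂ) : ℝ → ℂ :=
  f - affineInterpolant L f - ∑ i ∈ s,
    (∫ r in Ioo 0 L, (f - affineInterpolant L f) r * starRingEnd ℂ (b i r)) • (b i : ℝ → ℂ)

section ModeResidual

variable {ι : Type*} {b : HilbertBasis ι ℂ (Lp ℂ 2 (intervalMeasure L))}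
  {D : ι → Lp ℂ 2 (intervalMeasure L)} {μ : ι → ℝ} {s : Finset ι} {lam : ℝ}

theorem memLp_sub_affineInterpolant (hL : 0 < L) (hf : MemLp f 2 (intervalMeasure L)) :
    MemLp (f - affineInterpolant L f) 2 (intervalMeasure L) :=
  hf.sub ((isPrimitive_affineInterpolant f).memLp hL)

theorem modeResidual_sub (hL : 0 < L) (hf : MemLp f 2 (intervalMeasure L))
    (hg : MemLp g 2 (intervalMeasure L)) :
    modeResidual b s (f - g) = modeResidual b s f - modeResidual b s g := by
  have hbubble : f - g - affineInterpolant L (f - g) =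
      (f - affineInterpolant L f) - (g - affineInterpolant L g) := by
    rw [map_sub, sub_sub_sub_comm]
  have hcoeff : ∀ i, ∫ r in Ioo 0 L, (f - g - affineInterpolant L (f - g)) r *
        starRingEnd ℂ (b i r) =
      (∫ r in Ioo 0 L, (f - affineInterpolant L f) r * starRingEnd ℂ (b i r)) -
        ∫ r in Ioo 0 L, (g - affineInterpolant L g) r * starRingEnd ℂ (b i r) := by
    intro i
    have hb : MemLp (fun r ↦ starRingEnd ℂ (b i r)) 2 (intervalMeasure L) := (Lp.memLp (b i)).star
    rw [hbubble]
    simp only [Pi.sub_apply (f - affineInterpolant L f), sub_mul]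
    exact integral_sub ((memLp_sub_affineInterpolant hL hf).integrable_mul hb)
      ((memLp_sub_affineInterpolant hL hg).integrable_mul hb)
  simp only [modeResidual, hcoeff]
  rw [hbubble]
  simp only [sub_smul, Finset.sum_sub_distrib]
  abel

theorem truncationRemainder_toLp_fst_ae_eq
    (hf : MemLp (f - affineInterpolant L f) 2 (intervalMeasure L))
    (u : Lp ℂ 2 (intervalMeasure L)) :
    (truncationRemainder b D s (hf.toLp _, u)).1 =ᵐ[intervalMeasure L] modeResidual b s f := by
  rw [truncationRemainder_fst]
  refine (Lp.coeFn_sub _ _).trans (hf.coeFn_toLp.sub ?_)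
  refine (Lp.coeFn_finsetSum _ _).trans ?_
  filter_upwards [(Filter.eventually_all_finset s).2 fun i _ ↦
    Lp.coeFn_smul ⟪b i, hf.toLp _⟫_ℂ (b i)] with x hx
  simp only [Finset.sum_apply]
  exact Finset.sum_congr rfl fun i hi ↦
    (hx i hi).trans (by rw [inner_eq_setIntegral_mul_conj .rfl hf.coeFn_toLp])

theorem IsPrimitive.exists_mem_dirichletGraph (hL : 0 < L) (hF : IsPrimitive L F f)
    (hf : MemLp f 2 (intervalMeasure L)) (b : HilbertBasis ι ℂ (Lp ℂ 2 (intervalMeasure L)))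
    (D : ι → Lp ℂ 2 (intervalMeasure L)) (s : Finset ι) : ∃ p ∈ dirichletGraph L,
      (truncationRemainder b D s p).1 =ᵐ[intervalMeasure L] modeResidual b s F ∧
      ∀ q ∈ dirichletGraph L, ⟪q.2, p.2⟫_ℂ = ⟪q.2, hf.toLp f⟫_ℂ := by
  have haff := isPrimitive_affineInterpolant (L := L) F
  have hconst : MemLp (fun _ ↦ ((1 / L : ℝ) : ℂ) * (F L - F 0)) 2 (intervalMeasure L) :=
    memLp_const _
  have hbubble := memLp_sub_affineInterpolant hL (hF.memLp hL)
  refine ⟨_, (hF.sub haff).toLp_mem_dirichletGraph ?_ ?_ hbubble (hf.sub hconst),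
    truncationRemainder_toLp_fst_ae_eq hbubble _, fun q hq ↦ ?_⟩
  · rw [Pi.sub_apply, affineInterpolant_apply_zero, sub_self]
  · rw [Pi.sub_apply, affineInterpolant_apply_right hL, sub_self]
  have horth := inner_snd_toLp_eq_neg_of_mem_dirichletGraph hL hq
    ((isPrimitive_const _).isWeakDeriv hL) hconst MemLp.zero
  rw [MemLp.toLp_zero, inner_zero_right, neg_zero] at horth
  rw [MemLp.toLp_sub hf hconst, inner_sub_right, horth, sub_zero]

theorem ofReal_mul_eLpNorm_le {c : ℝ} (hc : 0 ≤ c) {u v : Lp ℂ 2 (intervalMeasure L)}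
    (h : c * ‖u‖ ≤ ‖v‖) :
    ENNReal.ofReal c * eLpNorm u 2 (intervalMeasure L) ≤ eLpNorm v 2 (intervalMeasure L) := by
  rw [← Lp.enorm_def, ← Lp.enorm_def, ← ofReal_norm, ← ofReal_norm, ← ENNReal.ofReal_mul hc]
  exact ENNReal.ofReal_le_ofReal h

theorem IsPrimitive.exists_isWeakDeriv_modeResidual (hL : 0 < L)
    (h : IsGraphEigenbasis (dirichletGraph L) b D μ) (hlam : ∀ i ∉ s, lam ≤ μ i)
    (hF : IsPrimitive L F f) (hf : MemLp f 2 (intervalMeasure L)) :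
    ∃ r, MemLp (modeResidual b s F) 2 (intervalMeasure L) ∧ MemLp r 2 (intervalMeasure L) ∧
      IsWeakDeriv L (modeResidual b s F) r ∧
      ENNReal.ofReal √lam * eLpNorm (modeResidual b s F) 2 (intervalMeasure L) ≤
        eLpNorm f 2 (intervalMeasure L) ∧
      ∀ g, MemLp g 2 (intervalMeasure L) → IsWeakDeriv L f g →
        ENNReal.ofReal √lam * eLpNorm r 2 (intervalMeasure L) ≤
          eLpNorm g 2 (intervalMeasure L) := by
  obtain ⟨p, hp, hae, hpf⟩ := hF.exists_mem_dirichletGraph hL hf b D s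
  set R := truncationRemainder b D s p
  have hRderiv := isWeakDeriv_of_mem_dirichletGraph hL (h.truncationRemainder_mem hp s)
  refine ⟨R.2, (memLp_congr_ae hae).1 (Lp.memLp _), Lp.memLp _, hRderiv.congr hae .rfl, ?_,
    fun g hg hfg ↦ ?_⟩
  · rw [← eLpNorm_congr_ae hae, ← eLpNorm_congr_ae hf.coeFn_toLp]
    exact ofReal_mul_eLpNorm_le (Real.sqrt_nonneg _)
      ((h.sqrt_mul_norm_truncationRemainder_fst_le hp hlam).trans
        (h.norm_truncationRemainder_snd_le hp s hpf))
  · rw [← eLpNorm_congr_ae hg.coeFn_toLp]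
    exact ofReal_mul_eLpNorm_le (Real.sqrt_nonneg _)
      (h.sqrt_mul_norm_truncationRemainder_snd_le hp hlam fun q hq ↦
        (hpf q hq).trans (inner_snd_toLp_eq_neg_of_mem_dirichletGraph hL hq hfg hf hg))

theorem mul_sobolevNorm_zero_modeResidual_le (hL : 0 < L)
    (h : IsGraphEigenbasis (dirichletGraph L) b D μ) (hlam : ∀ i ∉ s, lam ≤ μ i)
    (hF : ContinuousOn F (Icc 0 L)) (hFf : F =ᵐ[intervalMeasure L] f) :
    ENNReal.ofReal √lam * sobolevNorm L 0 (modeResidual b s F) ≤ sobolevNorm L 1 f := by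
  refine le_iInf₂ fun d ⟨hdf, hd, hderiv⟩ ↦ ?_
  subst hdf
  have hprim := (hderiv 0 one_pos).isPrimitive_of_continuousOn hL
    (integrableOn_of_memLp_two (hd 0 zero_le_one)) (integrableOn_of_memLp_two (hd 1 le_rfl)) hF hFf
  obtain ⟨-, hmem, -, -, hle, -⟩ := hprim.exists_isWeakDeriv_modeResidual hL h hlam (hd 1 le_rfl)
  refine IsWeakDerivChain.mul_sobolevNorm_le (d := fun _ ↦ modeResidual b s F)
    ⟨rfl, fun _ _ ↦ hmem, fun i hi ↦ absurd hi i.not_lt_zero⟩ fun i hi ↦ ?_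
  obtain rfl : i = 0 := Nat.le_zero.1 hi
  exact hle

theorem mul_sobolevNorm_one_modeResidual_le (hL : 0 < L)
    (h : IsGraphEigenbasis (dirichletGraph L) b D μ) (hlam : ∀ i ∉ s, lam ≤ μ i)
    (hF : ContinuousOn F (Icc 0 L)) (hFf : F =ᵐ[intervalMeasure L] f) :
    ENNReal.ofReal √lam * sobolevNorm L 1 (modeResidual b s F) ≤ sobolevNorm L 2 f := by
  refine le_iInf₂ fun d ⟨hdf, hd, hderiv⟩ ↦ ?_
  subst hdf
  have hd1 := hd 1 one_le_two
  have hprim := (hderiv 0 two_pos).isPrimitive_of_continuousOn hL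
    (integrableOn_of_memLp_two (hd 0 zero_le_two)) (integrableOn_of_memLp_two hd1) hF hFf
  obtain ⟨r, hmem, hr, hRr, hle, hle'⟩ := hprim.exists_isWeakDeriv_modeResidual hL h hlam hd1
  refine (hRr.isWeakDerivChain_one hmem hr).mul_sobolevNorm_le fun i hi ↦ ?_
  rcases Nat.le_one_iff_eq_zero_or_eq_one.1 hi with rfl | rfl
  · exact hle
  · exact hle' _ (hd 2 le_rfl) (hderiv 1 one_lt_two)

theorem mul_halfwayNorm_le_of_ae_eq_modeResidual (hL : 0 < L)
    (h : IsGraphEigenbasis (dirichletGraph L) b D μ) (hlam : ∀ i ∉ s, lam ≤ μ i)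
    (hf : ContinuousOn f (Icc 0 L))
    (hg : g =ᵐ[intervalMeasure L] modeResidual b s f) :
    ENNReal.ofReal √lam * halfwayNorm (sobolevNorm L 0) (sobolevNorm L 1) g ≤
      halfwayNorm (sobolevNorm L 1) (sobolevNorm L 2) f := by
  refine mul_halfwayNorm_le ENNReal.ofReal_ne_top fun t ht ↦ mul_kFunctional_le ht fun f₁ hf₁ ↦ ?_
  obtain ⟨F₁, _, hF₁, hF₁f⟩ := exists_isPrimitive_of_sobolevNorm_lt_top hL hf₁
  have hcont := hF₁.continuousOn hL
  refine ⟨modeResidual b s F₁, ?_, mul_sobolevNorm_one_modeResidual_le hL h hlam hcont hF₁f⟩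
  have hsub : g - modeResidual b s F₁ =ᵐ[intervalMeasure L] modeResidual b s (f - F₁) := by
    rw [modeResidual_sub hL (memLp_intervalMeasure_of_continuousOn hf) (hF₁.memLp hL)]
    exact hg.sub .rfl
  exact (mul_le_mul_right (sobolevNorm_le_of_ae_eq hsub) _).trans
    (mul_sobolevNorm_zero_modeResidual_le hL h hlam (hf.sub hcont)
      ((Filter.EventuallyEq.refl _ f).sub hF₁f))

end ModeResidual

/-! ### Edge modes -/

namespace InterfaceEdge

section Extend

variable (e : InterfaceEdge)

/-- The function on the plane whose value at the point of the closed edge `e` with arc length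
parameter `s` is `f s`. -/
noncomputable def extend (f : ℝ → ℂ) : EuclideanPlane → ℂ :=
  f ∘ Function.invFunOn e.param (Icc 0 e.length)

theorem extend_param (f : ℝ → ℂ) {s : ℝ} (hs : s ∈ Icc 0 e.length) :
    e.extend f (e.param s) = f s :=
  congrArg f (e.injOn.leftInvOn_invFunOn hs)

theorem extend_comp_param_ae_eq (f : ℝ → ℂ) :
    e.extend f ∘ e.param =ᵐ[intervalMeasure e.length] f :=
  (ae_restrict_mem measurableSet_Ioo).mono fun _ hs ↦ e.extend_param f (Ioo_subset_Icc_self hs)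

end Extend

variable {e : InterfaceEdge}

theorem exists_continuousOnClosure_of_normHThreeHalves_lt_top {u : EuclideanPlane → ℂ}
    (h : e.normHThreeHalves u < ⊤) :
    ∃ w, e.ContinuousOnClosure w ∧ e.AEEqual w u := by
  have hL := e.length_pos
  obtain ⟨f₁, h₀, h₁⟩ := exists_lt_top_of_halfwayNorm_lt_top h
  obtain ⟨F₀, _, hF₀, hF₀f⟩ := exists_isPrimitive_of_sobolevNorm_lt_top hL h₀
  obtain ⟨F₁, _, hF₁, hF₁f⟩ := exists_isPrimitive_of_sobolevNorm_lt_top hL h₁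
  refine ⟨e.extend (F₀ + F₁), ?_, (e.extend_comp_param_ae_eq _).trans ?_⟩
  · exact ((hF₀.continuousOn hL).add (hF₁.continuousOn hL)).congr fun s hs ↦ e.extend_param _ hs
  · exact (hF₀f.add hF₁f).trans (by rw [sub_add_cancel])

theorem isEigenpair_of_isPrimitive {T t : ℝ → ℂ} {μ : ℝ} (hT : IsPrimitive e.length T t)
    (ht : IsPrimitive e.length t (-(μ : ℂ) • T)) (hT0 : T 0 = 0) (hTL : T e.length = 0)
    {σ : EuclideanPlane → ℂ} (hσ : T =ᵐ[intervalMeasure e.length] σ ∘ e.param) :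
    e.IsEigenpair σ μ := by
  have hL := e.length_pos
  have hTderiv := hT.isWeakDeriv hL
  have hTmem := hT.memLp hL
  have htmem := ht.memLp hL
  refine ⟨⟨?_, T, hT.continuousOn hL, hσ, hT0, hTL⟩, fun η hη dτ dη hdτ hτderiv hdη hηderiv ↦ ?_⟩
  · exact ((hTderiv.congr hσ .rfl).isWeakDerivChain_one ((memLp_congr_ae hσ).1 hTmem)
      htmem).sobolevNorm_lt_top
  have hdτt : dτ =ᵐ[intervalMeasure e.length] t := (hτderiv.congr hσ.symm .rfl).unique hTderiv
    (integrableOn_of_memLp_two hdτ) (integrableOn_of_memLp_two htmem)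
  have hηmem := hη.exists_isWeakDeriv.1
  have hgraph := hη.toLp_mem_dirichletGraph hL hηderiv hηmem hdη
  have hinner := inner_snd_toLp_eq_neg_of_mem_dirichletGraph hL hgraph (ht.isWeakDeriv hL) htmem
    (hTmem.const_smul (-(μ : ℂ)))
  rw [MemLp.toLp_const_smul _ hTmem, inner_smul_right, neg_mul, neg_neg,
    inner_eq_setIntegral_mul_conj hdη.coeFn_toLp (htmem.coeFn_toLp.trans hdτt.symm),
    inner_eq_setIntegral_mul_conj hηmem.coeFn_toLp (hTmem.coeFn_toLp.trans hσ)] at hinner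
  exact hinner

theorem isEigenpair_extend_sin (e : InterfaceEdge) (m : ℕ) :
    e.IsEigenpair (e.extend fun s ↦ (Real.sin (m * Real.pi * s / e.length) : ℂ))
      ((m * Real.pi / e.length) ^ 2) := by
  set ω : ℝ := m * Real.pi / e.length with hω
  have harg : ∀ s : ℝ, m * Real.pi * s / e.length = ω * s := fun s ↦ by rw [hω, div_mul_eq_mul_div]
  simp only [harg]
  have hlin : ∀ s, HasDerivAt (fun s : ℝ ↦ ω * s) ω s := fun s ↦ by
    simpa using (hasDerivAt_id s).const_mul ω
  have hsin : IsPrimitive e.length (fun s ↦ (Real.sin (ω * s) : ℂ))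
      (fun s ↦ (Real.cos (ω * s) * ω : ℝ)) :=
    isPrimitive_of_hasDerivAt (fun s ↦ (hlin s).sin.ofReal_comp) (by fun_prop)
  have hcos : IsPrimitive e.length (fun s ↦ ((Real.cos (ω * s) * ω : ℝ) : ℂ))
      (-((ω ^ 2 : ℝ) : ℂ) • fun s ↦ (Real.sin (ω * s) : ℂ)) := by
    refine isPrimitive_of_hasDerivAt (fun s ↦ ?_) (by fun_prop)
    refine ((hlin s).cos.mul_const ω).ofReal_comp.congr_deriv ?_
    simp only [Pi.smul_apply, smul_eq_mul]
    push_cast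
    ring
  have hend : Real.sin (ω * e.length) = 0 := by
    rw [hω, div_mul_cancel₀ _ e.length_pos.ne', Real.sin_nat_mul_pi]
  exact isEigenpair_of_isPrimitive hsin hcos (by simp) (by rw [hend, Complex.ofReal_zero])
    (e.extend_comp_param_ae_eq _).symm

theorem IsEigenpair.exists_mem_dirichletGraph {σ : EuclideanPlane → ℂ} {μ : ℝ}
    (h : e.IsEigenpair σ μ) : ∃ p ∈ dirichletGraph e.length,
      p.1 =ᵐ[intervalMeasure e.length] σ ∘ e.param ∧
      ∀ q ∈ dirichletGraph e.length, ⟪p.2, q.2⟫_ℂ = μ * ⟪p.1, q.1⟫_ℂ := by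
  have hL := e.length_pos
  obtain ⟨hmem, dσ, hdσ, hderiv⟩ := h.1.exists_isWeakDeriv
  refine ⟨(hmem.toLp _, hdσ.toLp _), h.1.toLp_mem_dirichletGraph hL hderiv hmem hdσ,
    hmem.coeFn_toLp, fun q hq ↦ ?_⟩
  have heigen := h.2 q.1 (memH10_of_mem_dirichletGraph hL hq) dσ q.2 hdσ hderiv (Lp.memLp _)
    (isWeakDeriv_of_mem_dirichletGraph hL hq)
  have hflip : ⟪q.2, hdσ.toLp dσ⟫_ℂ = μ * ⟪q.1, hmem.toLp _⟫_ℂ := by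
    rwa [inner_eq_setIntegral_mul_conj .rfl hdσ.coeFn_toLp,
      inner_eq_setIntegral_mul_conj .rfl hmem.coeFn_toLp]
  rw [← inner_conj_symm, hflip, map_mul, Complex.conj_ofReal, inner_conj_symm]

theorem exists_mem_span_ae_eq {ι κ : Type*} {T : ι → Lp ℂ 2 (intervalMeasure e.length)}
    {τ : κ → EuclideanPlane → ℂ} {S : Set κ}
    (hT : ∀ n ∈ S, ∃ i, T i =ᵐ[intervalMeasure e.length] τ n ∘ e.param) {v : EuclideanPlane → ℂ}
    (hv : v ∈ Submodule.span ℂ (τ '' S)) :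
    ∃ u ∈ Submodule.span ℂ (range T), u =ᵐ[intervalMeasure e.length] v ∘ e.param := by
  induction hv using Submodule.span_induction with
  | mem x hx =>
    obtain ⟨n, hn, rfl⟩ := hx
    obtain ⟨i, hi⟩ := hT n hn
    exact ⟨T i, Submodule.subset_span (mem_range_self i), hi⟩
  | zero => exact ⟨0, Submodule.zero_mem _, Lp.coeFn_zero ..⟩
  | add x y _ _ hx hy =>
    obtain ⟨u, hu, hux⟩ := hx
    obtain ⟨w, hw, hwy⟩ := hy
    exact ⟨u + w, Submodule.add_mem _ hu hw, (Lp.coeFn_add u w).trans (hux.add hwy)⟩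
  | smul a x _ hx =>
    obtain ⟨u, hu, hux⟩ := hx
    exact ⟨a • u, Submodule.smul_mem _ a hu, (Lp.coeFn_smul a u).trans (hux.const_smul a)⟩

namespace IsEdgeModes

variable {τ : ℕ → EuclideanPlane → ℂ} {ev : ℕ → ℝ}

theorem orthogonal_span_eq_bot (h : e.IsEdgeModes τ ev)
    {T : ℕ+ → Lp ℂ 2 (intervalMeasure e.length)}
    (hT : ∀ i : ℕ+, T i =ᵐ[intervalMeasure e.length] τ i ∘ e.param) :
    (Submodule.span ℂ (range T))ᗮ = ⊥ := by
  refine (Submodule.eq_bot_iff _).2 fun u hu ↦ ?_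
  rw [Lp.eq_zero_iff_ae_eq_zero]
  refine ae_eq_zero_of_forall_integral_sin_mul_eq_zero e.length_pos (Lp.memLp u) fun m _ ↦ ?_
  obtain ⟨v, hv, hvsin⟩ := h.exhaustive _ _ (e.isEigenpair_extend_sin m)
  obtain ⟨x, hx, hxv⟩ := exists_mem_span_ae_eq (T := T) (fun n hn ↦ ⟨⟨n, hn.1⟩, hT ⟨n, hn.1⟩⟩) hv
  have hinner := (Submodule.mem_orthogonal _ u).1 hu x hx
  rw [inner_eq_setIntegral_mul_conj (hxv.trans (hvsin.trans (e.extend_comp_param_ae_eq _)))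
    .rfl] at hinner
  simpa only [Complex.conj_ofReal, mul_comm] using hinner

theorem exists_isGraphEigenbasis (h : e.IsEdgeModes τ ev) :
    ∃ (b : HilbertBasis ℕ+ ℂ (Lp ℂ 2 (intervalMeasure e.length)))
      (D : ℕ+ → Lp ℂ 2 (intervalMeasure e.length)),
      (∀ i : ℕ+, b i =ᵐ[intervalMeasure e.length] τ i ∘ e.param) ∧
      IsGraphEigenbasis (dirichletGraph e.length) b D fun i ↦ ev i := by
  choose p hp hpτ hpeigen using fun i : ℕ+ ↦ (h.eigenpair i i.pos).exists_mem_dirichletGraph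
  have hortho : Orthonormal ℂ fun i ↦ (p i).1 := by
    classical
    rw [orthonormal_iff_ite]
    intro i j
    rw [inner_eq_setIntegral_mul_conj (hpτ i) (hpτ j)]
    exact (h.orthonormal j i j.pos i.pos).trans
      (if_congr (by rw [PNat.coe_inj, eq_comm]) rfl rfl)
  have hspan := h.orthogonal_span_eq_bot hpτ
  have hb : ∀ i, HilbertBasis.mkOfOrthogonalEqBot hortho hspan i = (p i).1 :=
    congrFun (HilbertBasis.coe_mkOfOrthogonalEqBot hortho hspan)
  refine ⟨HilbertBasis.mkOfOrthogonalEqBot hortho hspan, fun i ↦ (p i).2, fun i ↦ ?_,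
    fun i ↦ ?_, fun i q hq ↦ ?_⟩
  · exact hb i ▸ hpτ i
  · exact hb i ▸ hp i
  · exact hb i ▸ hpeigen i q hq

theorem ev_pos (h : e.IsEdgeModes τ ev) {n : ℕ} (hn : 1 ≤ n) : 0 < ev n := by
  obtain ⟨b, D, -, hbasis⟩ := h.exists_isGraphEigenbasis
  lift n to ℕ+ using hn
  have hsq : ‖D n‖ ^ 2 = ev n := by
    have hinner := hbasis.inner_snd n _ (hbasis.mem n)
    rw [inner_self_eq_norm_sq_to_K, inner_self_eq_norm_sq_to_K, b.orthonormal.norm_eq_one n,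
      RCLike.ofReal_one, one_pow, mul_one] at hinner
    exact_mod_cast hinner
  have hD : D n ≠ 0 := fun hzero ↦
    b.orthonormal.ne_zero n (fst_eq_zero_of_mem_dirichletGraph (hbasis.mem n) hzero)
  exact hsq ▸ pow_pos (norm_pos_iff.2 hD) 2

theorem exists_mem_modeSpace_mul_normHHalf_le (h : e.IsEdgeModes τ ev) {n : ℕ} (hn : 1 ≤ n)
    {w I : EuclideanPlane → ℂ} (hw : e.ContinuousOnClosure w)
    (hI : I ∘ e.param =ᵐ[intervalMeasure e.length] affineInterpolant e.length (w ∘ e.param)) :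
    ∃ v ∈ modeSpace τ n,
      ENNReal.ofReal √(ev n) * e.normHHalf (w - I - v) ≤ e.normHThreeHalves w := by
  obtain ⟨b, D, hbτ, hbasis⟩ := h.exists_isGraphEigenbasis
  lift n to ℕ+ using hn
  set f := w ∘ e.param
  set c : ℕ+ → ℂ := fun i ↦
    ∫ r in Ioo 0 e.length, (f - affineInterpolant e.length f) r * starRingEnd ℂ (b i r)
  refine ⟨∑ i ∈ Finset.Icc 1 n, c i • τ i, Submodule.sum_mem _ fun i hi ↦ Submodule.smul_mem _ _
    (Submodule.subset_span ⟨i, ⟨i.pos, (Finset.mem_Icc.1 hi).2⟩, rfl⟩), ?_⟩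
  have hlam : ∀ i ∉ Finset.Icc 1 n, ev n ≤ ev i := fun i hi ↦
    h.monotone n i n.pos (le_of_lt (by simpa using hi))
  refine mul_halfwayNorm_le_of_ae_eq_modeResidual e.length_pos hbasis hlam hw ?_
  filter_upwards [hI, (Filter.eventually_all_finset (Finset.Icc 1 n)).2 fun i _ ↦ hbτ i]
    with s hs hbs
  have hsum : ∑ i ∈ Finset.Icc 1 n, c i * τ i (e.param s) = ∑ i ∈ Finset.Icc 1 n, c i * b i s :=
    Finset.sum_congr rfl fun i hi ↦ congrArg (c i * ·) (hbs i hi).symm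
  simp only [modeResidual, Function.comp_apply, Pi.sub_apply, Finset.sum_apply, Pi.smul_apply,
    smul_eq_mul] at hs ⊢
  rw [hs, hsum]
  rfl

end IsEdgeModes

end InterfaceEdge

/-! ### The nodal interpolant on an edge -/

theorem exists_eqOn_affine_of_deriv_deriv_eq_zero {E : Type*} [NormedAddCommGroup E]
    [NormedSpace ℝ E] {q : ℝ → E} {s : Set ℝ} (hs : IsOpen s) (hs' : IsPreconnected s)
    (hq : DifferentiableOn ℝ q s) (hq' : DifferentiableOn ℝ (deriv q) s)
    (hzero : EqOn (deriv (deriv q)) 0 s) : ∃ c k : E, EqOn q (fun x ↦ c + x • k) s := by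
  obtain ⟨k, hk⟩ := hs.exists_is_const_of_deriv_eq_zero hs' hq' hzero
  have hlin : ∀ x, HasDerivAt (fun x : ℝ ↦ x • k) k x := fun x ↦ by
    simpa using (hasDerivAt_id x).smul_const k
  obtain ⟨c, hc⟩ := hs.exists_is_const_of_deriv_eq_zero (f := fun x ↦ q x - x • k) hs'
    (hq.sub fun x _ ↦ (hlin x).differentiableAt.differentiableWithinAt) fun x hx ↦ by
      have hderiv := ((hq.differentiableAt (hs.mem_nhds hx)).hasDerivAt.sub (hlin x)).deriv
      rwa [hk x hx, sub_self] at hderiv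
  exact ⟨c, k, fun x hx ↦ sub_eq_iff_eq_add.1 (hc x hx)⟩

theorem eq_affine_of_harmonicOnNhd {E : Type*} [NormedAddCommGroup E] [NormedSpace ℝ E]
    (hL : 0 < L) {q : ℝ → E} (hc : ContinuousOn q (Icc 0 L))
    (hq : InnerProductSpace.HarmonicOnNhd q (Ioo 0 L)) {s : ℝ} (hs : s ∈ Icc 0 L) :
    q s = q 0 + (s / L) • (q L - q 0) := by
  have hsmooth : ContDiffOn ℝ 2 q (Ioo 0 L) := hq.contDiffOn
  have hsmooth' := hsmooth.deriv_of_isOpen isOpen_Ioo (m := 1) (by norm_num)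
  have hzero : EqOn (deriv (deriv q)) 0 (Ioo 0 L) := fun x hx ↦ by
    simpa only [InnerProductSpace.laplacian_eq_iteratedDeriv_real, iteratedDeriv_succ,
      iteratedDeriv_zero] using (hq x hx).2.self_of_nhds
  obtain ⟨c, k, hopen⟩ := exists_eqOn_affine_of_deriv_deriv_eq_zero isOpen_Ioo isPreconnected_Ioo
    (hsmooth.differentiableOn (by norm_num)) (hsmooth'.differentiableOn (by norm_num)) hzero
  have hclosed : EqOn q (fun x ↦ c + x • k) (Icc 0 L) :=
    hopen.of_subset_closure hc (by fun_prop) Ioo_subset_Icc_self (closure_Ioo hL.ne).ge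
  rw [hclosed hs, hclosed (left_mem_Icc.2 hL.le), hclosed (right_mem_Icc.2 hL.le)]
  simp only [zero_smul, add_zero, add_sub_cancel_left, smul_smul, div_mul_cancel₀ _ hL.ne']

namespace DecompositionInterface.IsVertexBasis

variable {N : DecompositionInterface} {φ : EuclideanPlane → EuclideanPlane → ℝ}

theorem nodalInterpolant_apply_vertex (hφ : N.IsVertexBasis φ) (w : EuclideanPlane → ℂ)
    {q : EuclideanPlane} (hq : q ∈ N.vertices) : N.nodalInterpolant φ w q = w q := by
  rw [nodalInterpolant, Finset.sum_eq_single_of_mem q hq fun p hp hpq ↦ by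
    rw [hφ.nodal p hp q hq, if_neg hpq, Complex.ofReal_zero, mul_zero],
    hφ.nodal q hq q hq, if_pos rfl, Complex.ofReal_one, mul_one]

theorem nodalInterpolant_param (hφ : N.IsVertexBasis φ) (k : Fin N.numEdges)
    (w : EuclideanPlane → ℂ) {s : ℝ} (hs : s ∈ Icc 0 (N.edge k).length) :
    N.nodalInterpolant φ w ((N.edge k).param s) =
      affineInterpolant (N.edge k).length (w ∘ (N.edge k).param) s := by
  set e := N.edge k
  have hφs : ∀ p ∈ N.vertices, φ p (e.param s) = φ p (e.param 0) +
      s / e.length * (φ p (e.param e.length) - φ p (e.param 0)) := fun p hp ↦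
    eq_affine_of_harmonicOnNhd e.length_pos (hφ.continuousOn p hp k) (hφ.harmonic p hp k) hs
  calc N.nodalInterpolant φ w (e.param s)
      = N.nodalInterpolant φ w (e.param 0) + (s / e.length : ℝ) *
          (N.nodalInterpolant φ w (e.param e.length) - N.nodalInterpolant φ w (e.param 0)) := by
        simp only [nodalInterpolant, ← Finset.sum_sub_distrib, Finset.mul_sum,
          ← Finset.sum_add_distrib]
        refine Finset.sum_congr rfl fun p hp ↦ ?_
        rw [hφs p hp]
        push_cast
        ring
    _ = affineInterpolant e.length (w ∘ e.param) s := by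
        rw [hφ.nodalInterpolant_apply_vertex w (N.start_mem k),
          hφ.nodalInterpolant_apply_vertex w (N.end_mem k), affineInterpolant_apply]
        rfl

end DecompositionInterface.IsVertexBasis

end

theorem mainTheorem7 (N : DecompositionInterface) (k : Fin N.numEdges) :
    ∃ C : ℝ, 0 < C ∧
      ∀ (φ : EuclideanPlane → EuclideanPlane → ℝ), N.IsVertexBasis φ →
      ∀ (τ : ℕ → EuclideanPlane → ℂ) (ev : ℕ → ℝ), (N.edge k).IsEdgeModes τ ev →
      ∀ u : EuclideanPlane → ℂ, (N.edge k).normHThreeHalves u < ⊤ →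
        (∃ w, (N.edge k).ContinuousOnClosure w ∧ (N.edge k).AEEqual w u) ∧
        ∀ w, (N.edge k).ContinuousOnClosure w → (N.edge k).AEEqual w u →
        ∀ n : ℕ, 1 ≤ n →
          ⨅ v ∈ modeSpace τ n,
              (N.edge k).normHHalf (fun x => w x - N.nodalInterpolant φ w x - v x) ≤
            ENNReal.ofReal (C / √(ev n)) * (N.edge k).normHThreeHalves w := by
  refine ⟨1, one_pos, fun φ hφ τ ev h u hu ↦
    ⟨InterfaceEdge.exists_continuousOnClosure_of_normHThreeHalves_lt_top hu, fun w hw _ n hn ↦ ?_⟩⟩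
  have hinterp : N.nodalInterpolant φ w ∘ (N.edge k).param
      =ᵐ[intervalMeasure (N.edge k).length]
        affineInterpolant (N.edge k).length (w ∘ (N.edge k).param) :=
    (ae_restrict_mem measurableSet_Ioo).mono fun _ hs ↦
      hφ.nodalInterpolant_param k w (Ioo_subset_Icc_self hs)
  obtain ⟨v, hv, hle⟩ := h.exists_mem_modeSpace_mul_normHHalf_le hn hw hinterp
  have hpos : 0 < √(ev n) := Real.sqrt_pos.2 (h.ev_pos hn)
  refine (iInf₂_le v hv).trans ?_
  rw [one_div, ENNReal.ofReal_inv_of_pos hpos, mul_comm, ← div_eq_mul_inv,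
    ENNReal.le_div_iff_mul_le (Or.inl (ENNReal.ofReal_pos.2 hpos).ne')
      (Or.inl ENNReal.ofReal_ne_top), mul_comm]
  exact hle
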